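/- Let $A\in M_n(\mathbb Z)$ have determinant $\delta$ with $d:=|\delta|>1$ and characteristic polynomial $m$ irreducible over $\mathbb Q$. Let $K=\mathbb Q(x)$ be the number field generated by a root $x$ of $m$, let $\mathcal O_K$ be its ring of integers, and let $\Gamma=\mathcal O_K[\tfrac1x]^+\rtimes_x\mathbb Z$, so that $(b,k)(b',k')=(b+x^kb',\,k+k')$. *The tree.* For $l\in\mathbb Z$, a ball of level $l$ in $K$ is a set $\{y\in K: v_{\mathfrak p}(y-a)\ge l\,v_{\mathfrak p}(x)\text{ for all primes }\mathfrak p\mid x\}$ with $a\in K$. Let $T_d$ be the $(d+1)$-regular tree whose vertices are the pairs $(l,B)$, $B$ a ball of level $l$, with $(l+1,B)$ joined to $(l,B')$ if $B\subseteq B'$, realized with edges of length $1$ and with its path metric. An element $(b,k)\in\Gamma$ acts on $T_d$ by $(l,B)\mapsto(l+k,\,x^kB+b)$, i.e. as the matrix $\begin{pmatrix}x^k&b\\0&1\end{pmatrix}$. *The action on $\mathbb R^n$.* Fix a $\mathbb Z$-basis $e_1,\dots,e_n$ of $\mathcal O_K$ and let $A_x$ be the matrix of multiplication by $x$, $xe_i=\sum_j(A_x)_{ij}e_j$.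 Then $(b,k)$ acts on row vectors $w\in\mathbb R^n$ by $w\mapsto wA_x^k+(b_1,\dots,b_n)$, where $b=\sum_i b_ie_i$. *The flow space.* A generalized geodesic in a metric space $Y$ is a continuous map $c:\mathbb R\to Y$ for which there are $c_-\le c_+$ in $[-\infty,\infty]$, $c_-\ne\infty$, $c_+\ne-\infty$, such that $c$ is locally constant outside $(c_-,c_+)$ and an isometric embedding on $(c_-,c_+)$. Let $FS(Y)$ be the set of these, with the metric $d(c,c')=\int_{\mathbb R}\frac{d_Y(c(t),c'(t))}{2e^{|t|}}\,dt$. Put $HFS=FS(T_d)\times\mathbb R^n$, with the product topology, the diagonal $\Gamma$-action, and the flow $\Phi_\tau(c,w)=(c(\cdot+\tau),w)$. The period of a point $p\in HFS$, or of its flow line, is $\inf\{\tau>0:\Phi_\tau(p)=gp\text{ for some }g\in\Gamma\}\in[0,\infty]$. Let $HFS^{\mathbb R}$ be the set of $p$ with $\Phi_\tau(p)=p$ for all $\tau\in\mathbb R$. Then: (i) $\Gamma$ acts properly on $HFS$ (every point has an open neighbourhood $U$ such that $gU\cap U\neq\emptyset$ for only finitely many $g\in\Gamma$) and cocompactly (there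 is a compact set whose $\Gamma$-translates cover $HFS$). (ii) For every $C>0$ there are only finitely many $\Gamma$-orbits of flow lines whose period lies in $(0,C)$. (iii) $HFS\setminus HFS^{\mathbb R}$ is locally connected. (iv) The number $k_\Gamma:=\sup\{|H|: H\le\Gamma\text{ a finite subgroup}\}$ and the covering dimension of $HFS\setminus HFS^{\mathbb R}$ are finite. -/

import Mathlib

open NumberField IsDedekindDomain MeasureTheory Module
open scoped Matrix Pointwise ENNReal

noncomputable section

namespace HorizontalFlow

/-! ### Generalized geodesics and the flow space of a metric space -/

section FlowSpace

set_option linter.unusedSectionVars false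

variable {X : Type*} [MetricSpace X]

/-- The open interval `(a, b) ⊆ ℝ` with extended real end points. -/
def eInterval (a b : EReal) : Set ℝ := {t | a < (t : EReal) ∧ (t : EReal) < b}

/-- `c : ℝ → X` is a generalized geodesic: it is continuous and there are
`c₋ ≤ c₊` in `[-∞, ∞]`, `c₋ ≠ ∞`, `c₊ ≠ -∞`, such that `c` is locally constant on the complement of
`(c₋, c₊)` and an isometric embedding on `(c₋, c₊)`. -/
def IsGeneralizedGeodesic (c : ℝ → X) : Prop :=
  Continuous c ∧ ∃ a b : EReal, a ≤ b ∧ a ≠ ⊤ ∧ b ≠ ⊥ ∧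
    IsLocallyConstant ((eInterval a b)ᶜ.domRestrict c) ∧ Isometry ((eInterval a b).domRestrict c)

theorem locConst_apply_eq {c : ℝ → X} {S : Set ℝ} (h : IsLocallyConstant (S.domRestrict c))
    {s t : ℝ} (hst : s ≤ t) (hS : Set.Icc s t ⊆ S) : c s = c t := by
  have hp : IsPreconnected ((↑) ⁻¹' Set.Icc s t : Set S) := by
    rw [← Topology.IsInducing.subtypeVal.isPreconnected_image, Subtype.image_preimage_coe,
      Set.inter_eq_right.2 hS]
    exact isPreconnected_Icc
  exact h.apply_eq_of_isPreconnected hp (x := ⟨s, hS ⟨le_rfl, hst⟩⟩) (y := ⟨t, hS ⟨hst, le_rfl⟩⟩)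
    ⟨le_rfl, hst⟩ ⟨hst, le_rfl⟩

theorem isometry_closure {c : ℝ → X} (hc : Continuous c) {S : Set ℝ}
    (h : Isometry (S.domRestrict c)) {s t : ℝ} (hst : s ≤ t) (hS : Set.Ioo s t ⊆ S) :
    dist (c s) (c t) ≤ t - s := by
  rcases hst.eq_or_lt with rfl | hlt
  · simp
  have hcl : IsClosed {p : ℝ × ℝ | dist (c p.1) (c p.2) ≤ |p.1 - p.2|} :=
    isClosed_le (by fun_prop) (by fun_prop)
  have hsub : Set.Ioo s t ×ˢ Set.Ioo s t ⊆ {p : ℝ × ℝ | dist (c p.1) (c p.2) ≤ |p.1 - p.2|} := by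
    rintro ⟨u, v⟩ ⟨hu, hv⟩
    exact (h.dist_eq ⟨u, hS hu⟩ ⟨v, hS hv⟩).le
  have := closure_minimal hsub hcl
  rw [closure_prod_eq, closure_Ioo hlt.ne] at this
  have h1 := this (show (s, t) ∈ _ from ⟨⟨le_rfl, hst⟩, ⟨hst, le_rfl⟩⟩)
  simp only [Set.mem_ofPred_eq] at h1
  rwa [abs_sub_comm, abs_of_nonneg (sub_nonneg.2 hst)] at h1

theorem IsGeneralizedGeodesic.dist_le {c : ℝ → X} (hc : IsGeneralizedGeodesic c) (s t : ℝ) :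
    dist (c s) (c t) ≤ |s - t| := by
  wlog hst : s ≤ t generalizing s t
  · rw [dist_comm, abs_sub_comm]; exact this t s (le_of_not_ge hst)
  obtain ⟨hcont, a, b, hab, -, -, hl, hi⟩ := hc
  have key : ∀ e : EReal, ∃ r : ℝ, (r : EReal) = (e ⊔ s) ⊓ t := by
    intro e
    refine ⟨((e ⊔ s) ⊓ t).toReal, EReal.coe_toReal ?_ ?_⟩
    · exact ne_top_of_le_ne_top (EReal.coe_ne_top t) inf_le_right
    · exact ne_bot_of_le_ne_bot (EReal.coe_ne_bot s)
        (le_inf le_sup_right (EReal.coe_le_coe_iff.2 hst))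
  obtain ⟨a', ha'⟩ := key a
  obtain ⟨b', hb'⟩ := key b
  have hsa : s ≤ a' := by
    rw [← EReal.coe_le_coe_iff, ha']
    exact le_inf le_sup_right (EReal.coe_le_coe_iff.2 hst)
  have hbt : b' ≤ t := by
    rw [← EReal.coe_le_coe_iff, hb']; exact inf_le_right
  have hab' : a' ≤ b' := by
    rw [← EReal.coe_le_coe_iff, ha', hb']
    exact inf_le_inf_right _ (sup_le_sup_right hab _)
  have h1 : c s = c a' := by
    rcases hsa.eq_or_lt with h | h
    · rw [← h]
    · refine locConst_apply_eq hl hsa fun u hu hu' => ?_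
      have h2 : (a' : EReal) ≤ a := by
        have h3 : (s : EReal) < a' := EReal.coe_lt_coe_iff.2 h
        have h4 : (a' : EReal) ≤ a ⊔ s := ha' ▸ inf_le_left
        rcases le_sup_iff.1 h4 with h5 | h5
        · exact h5
        · exact absurd h3 (not_lt.2 h5)
      exact absurd (hu'.1) (not_lt.2 ((EReal.coe_le_coe_iff.2 hu.2).trans h2))
  have h2 : c b' = c t := by
    rcases hbt.eq_or_lt with h | h
    · rw [h]
    · refine locConst_apply_eq hl hbt fun u hu hu' => ?_
      have h2 : b ≤ (b' : EReal) := by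
        have h3 : (b' : EReal) < t := EReal.coe_lt_coe_iff.2 h
        have h4 : (b ⊔ s) ⊓ t ≤ (b' : EReal) := hb'.ge
        rcases inf_le_iff.1 h4 with h5 | h5
        · exact le_sup_left.trans h5
        · exact absurd h3 (not_lt.2 h5)
      exact absurd (hu'.2) (not_lt.2 (h2.trans (EReal.coe_le_coe_iff.2 hu.1)))
  have h3 : dist (c a') (c b') ≤ b' - a' := by
    refine isometry_closure hcont hi hab' fun u hu => ⟨?_, ?_⟩
    · by_contra hcon
      have hua := EReal.coe_lt_coe_iff.2 hu.1
      rw [ha', inf_lt_iff] at hua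
      rcases hua with h | h
      · exact hcon (le_sup_left.trans_lt h)
      · exact absurd (EReal.coe_lt_coe_iff.1 h) (not_lt.2 (hu.2.le.trans hbt))
    · have hub := EReal.coe_lt_coe_iff.2 hu.2
      rw [hb', lt_inf_iff, lt_sup_iff] at hub
      rcases hub.1 with h | h
      · exact h
      · exact absurd (EReal.coe_lt_coe_iff.1 h) (not_lt.2 (hsa.trans hu.1.le))
  rw [h1, ← h2, abs_sub_comm, abs_of_nonneg (sub_nonneg.2 hst)]
  linarith

variable (X) in
/-- The flow space `FS(X)`: the set of generalized geodesics of `X`. -/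
def FS : Type _ := {c : ℝ → X // IsGeneralizedGeodesic c}

theorem FS.integrable (c d : FS X) :
    Integrable fun t : ℝ => dist (c.1 t) (d.1 t) / (2 * Real.exp |t|) := by
  have hc : Continuous c.1 := c.2.1
  have hd : Continuous d.1 := d.2.1
  set D := dist (c.1 0) (d.1 0) with hD
  have hD0 : 0 ≤ D := dist_nonneg
  refine Integrable.mono' (integrable_inv_one_add_sq.const_mul (6 * D + 12)) ?_ ?_
  · refine Continuous.aestronglyMeasurable (Continuous.div (by fun_prop) (by fun_prop) ?_)
    intro t; positivity
  · refine Filter.Eventually.of_forall fun t => ?_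
    have h1 : dist (c.1 t) (d.1 t) ≤ D + 2 * |t| := by
      have ha := c.2.dist_le t 0
      have hb := d.2.dist_le 0 t
      have h4 := dist_triangle4 (c.1 t) (c.1 0) (d.1 0) (d.1 t)
      simp only [sub_zero, zero_sub, abs_neg] at ha hb
      linarith
    rw [Real.norm_of_nonneg (by positivity), div_le_iff₀ (by positivity), ← div_eq_mul_inv,
      div_mul_eq_mul_div, le_div_iff₀ (by positivity)]
    have hu : 0 ≤ |t| := abs_nonneg t
    have e0 : 1 + |t| ≤ Real.exp |t| := by linarith [Real.add_one_le_exp |t|]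
    have e2 := Real.pow_div_factorial_le_exp |t| hu 2
    have e3 := Real.pow_div_factorial_le_exp |t| hu 3
    norm_num [Nat.factorial] at e2 e3
    have step : (D + 2 * |t|) * (1 + t ^ 2) ≤ (6 * D + 12) * (2 * Real.exp |t|) := by
      have h2 : |t| * t ^ 2 = |t| ^ 3 := by rw [← sq_abs]; ring
      nlinarith [mul_le_mul_of_nonneg_left e0 hD0, mul_nonneg hD0 hu,
        mul_le_mul_of_nonneg_left e2 hD0, mul_nonneg hD0 (Real.exp_pos |t|).le]
    exact (mul_le_mul_of_nonneg_right h1 (by positivity)).trans step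

/-- The metric `d(c, d) = ∫ d_X(c t, d t) / (2 e^|t|) dt` on the flow space. -/
instance : MetricSpace (FS X) where
  dist c d := ∫ t : ℝ, dist (c.1 t) (d.1 t) / (2 * Real.exp |t|)
  dist_self c := by simp
  dist_comm c d := by simp only [dist_comm]
  dist_triangle c d e := by
    rw [← integral_add (c.integrable d) (d.integrable e)]
    refine integral_mono (c.integrable e) ((c.integrable d).add (d.integrable e)) fun t => ?_
    beta_reduce
    rw [← add_div]
    gcongr
    exact dist_triangle _ _ _
  eq_of_dist_eq_zero := by
    intro c d h
    have hc : Continuous c.1 := c.2.1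
    have hd : Continuous d.1 := d.2.1
    rw [integral_eq_zero_iff_of_nonneg (fun t => by positivity) (c.integrable d)] at h
    have hcont : Continuous fun t : ℝ => dist (c.1 t) (d.1 t) / (2 * Real.exp |t|) :=
      Continuous.div (by fun_prop) (by fun_prop) fun t => by positivity
    have h2 := (Continuous.ae_eq_iff_eq volume hcont continuous_zero).1 h
    refine Subtype.ext (funext fun t => ?_)
    have h3 := congrFun h2 t
    have h4 : (2 * Real.exp |t|) ≠ 0 := by positivity
    simpa [h4] using h3

theorem FS.dist_def (c d : FS X) :
    dist c d = ∫ t : ℝ, dist (c.1 t) (d.1 t) / (2 * Real.exp |t|) := rfl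

theorem IsGeneralizedGeodesic.shift {c : ℝ → X} (hc : IsGeneralizedGeodesic c) (τ : ℝ) :
    IsGeneralizedGeodesic fun t => c (t + τ) := by
  obtain ⟨hcont, a, b, hab, ha, hb, hl, hi⟩ := hc
  have hmem : ∀ t : ℝ, t ∈ eInterval (a - τ) (b - τ) ↔ t + τ ∈ eInterval a b := by
    intro t
    unfold eInterval
    simp only [Set.mem_ofPred_eq, EReal.coe_add]
    rw [EReal.sub_lt_iff (.inl (EReal.coe_ne_bot _)) (.inl (EReal.coe_ne_top _)),
      EReal.lt_sub_iff_add_lt (.inl (EReal.coe_ne_bot _)) (.inl (EReal.coe_ne_top _))]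
  refine ⟨by fun_prop, a - τ, b - τ, EReal.sub_le_sub hab le_rfl, ?_, ?_, ?_, ?_⟩
  · induction a <;> simp_all [← EReal.coe_sub]
  · induction b <;> simp_all [← EReal.coe_sub]
  · let φ : ↥(eInterval (a - τ) (b - τ))ᶜ → ↥(eInterval a b)ᶜ :=
      fun t => ⟨t.1 + τ, fun h => t.2 ((hmem _).2 h)⟩
    have hφ : Continuous φ := by fun_prop
    exact hl.comp_continuous hφ
  · refine Isometry.of_dist_eq fun s t => ?_
    have := hi.dist_eq ⟨s.1 + τ, (hmem _).1 s.2⟩ ⟨t.1 + τ, (hmem _).1 t.2⟩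
    refine this.trans ?_
    simp [Subtype.dist_eq]

/-- The flow on the flow space, `Φ_τ(c)(t) = c(t + τ)`. -/
def FS.flow (τ : ℝ) (c : FS X) : FS X := ⟨fun t => c.1 (t + τ), c.2.shift τ⟩

variable {G : Type*} [Group G] [MulAction G X] [IsIsometricSMul G X]

theorem IsGeneralizedGeodesic.smul {c : ℝ → X} (hc : IsGeneralizedGeodesic c) (g : G) :
    IsGeneralizedGeodesic fun t => g • c t := by
  obtain ⟨hcont, a, b, hab, ha, hb, hl, hi⟩ := hc
  exact ⟨hcont.const_smul g, a, b, hab, ha, hb, hl.comp (g • ·), (isometry_smul X g).comp hi⟩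

/-- Isometries of `X` act on `FS(X)` by composition. -/
instance : MulAction G (FS X) where
  smul g c := ⟨fun t => g • c.1 t, c.2.smul g⟩
  one_smul c := Subtype.ext (funext fun t => one_smul G (c.1 t))
  mul_smul g h c := Subtype.ext (funext fun t => mul_smul g h (c.1 t))

instance : IsIsometricSMul G (FS X) where
  isometry_smul g := Isometry.of_dist_eq fun c d => by
    rw [FS.dist_def, FS.dist_def]
    exact integral_congr_ae (.of_forall fun t => by
      change dist (g • c.1 t) (g • d.1 t) / _ = _
      rw [dist_smul])

end FlowSpace

/-! ### The group `Γ = 𝓞_K[1/x]⁺ ⋊ₓ ℤ` -/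

section Group

variable {K : Type*} [Field K] (x : 𝓞 K)

/-- The subring `𝓞_K[1/x]` of `K`. -/
abbrev InvRing : Subalgebra (𝓞 K) K := Algebra.adjoin (𝓞 K) {(x : K)⁻¹}

variable [NeZero x]

theorem coe_ne_zero : (x : K) ≠ 0 := by
  have := NeZero.ne x
  exact_mod_cast this

/-- `x` as a unit of `𝓞_K[1/x]`. -/
def xUnit : (InvRing x)ˣ where
  val := ⟨x, (InvRing x).algebraMap_mem x⟩
  inv := ⟨(x : K)⁻¹, Algebra.subset_adjoin rfl⟩
  val_inv := Subtype.ext (mul_inv_cancel₀ (coe_ne_zero x))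
  inv_val := Subtype.ext (inv_mul_cancel₀ (coe_ne_zero x))

/-- The action of `ℤ` on the additive group of `𝓞_K[1/x]`, `k` acting as multiplication by `x ^ k`. -/
def xAction : Multiplicative ℤ →* MulAut (Multiplicative (InvRing x)) :=
  (MulAutMultiplicative (InvRing x)).symm.toMonoidHom.comp
    (AddAut.mulLeft.comp (zpowersHom (InvRing x)ˣ (xUnit x)))

/-- The group `Γ = 𝓞_K[1/x]⁺ ⋊ₓ ℤ`. -/
abbrev Gamma : Type _ := Multiplicative (InvRing x) ⋊[xAction x] Multiplicative ℤ

variable {x}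

/-- The component `b ∈ 𝓞_K[1/x] ⊆ K` of `g = (b, k) ∈ Γ`. -/
def Gamma.b (g : Gamma x) : K := (g.left.toAdd : InvRing x)

/-- The component `k ∈ ℤ` of `g = (b, k) ∈ Γ`. -/
def Gamma.k (g : Gamma x) : ℤ := g.right.toAdd

@[simp] theorem Gamma.b_one : (1 : Gamma x).b = 0 := rfl
@[simp] theorem Gamma.k_one : (1 : Gamma x).k = 0 := rfl
@[simp] theorem Gamma.k_mul (g h : Gamma x) : (g * h).k = g.k + h.k := rfl

theorem xUnit_zpow (k : ℤ) : (((xUnit x ^ k : (InvRing x)ˣ) : InvRing x) : K) = (x : K) ^ k := by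
  have h := congrArg Units.val
    (map_zpow (Units.map ((InvRing x).val : InvRing x →* K)) (xUnit x) k)
  rw [Units.val_zpow_eq_zpow_val] at h
  exact h

@[simp] theorem Gamma.b_mul (g h : Gamma x) : (g * h).b = g.b + (x : K) ^ g.k * h.b := by
  rw [← xUnit_zpow]; rfl

end Group

/-! ### The tree `T_d` -/

section Tree

variable {K : Type*} [Field K] [NumberField K] (x : 𝓞 K)

/-- The ball of level `l` around `a` in `K`: all `y` with `v_𝔭(y - a) ≥ l v_𝔭(x)` for each prime
`𝔭` that divides `x` (`HeightOneSpectrum.valuation` is multiplicative, so `≥` becomes `≤`). -/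
def levelBall (a : K) (l : ℤ) : Set K :=
  {y | ∀ 𝔭 : HeightOneSpectrum (𝓞 K), 𝔭.asIdeal ∣ Ideal.span {x} →
    𝔭.valuation K (y - a) ≤ 𝔭.valuation K (x : K) ^ l}

/-- The (geometric realization of the) tree `T_d`, with edges of length one.

The vertices are the pairs of an integer `l` and a ball of level `l` in `K`; the vertex `(l + 1, B)`
is joined to `(l, B')`, where `B'` is the ball of level `l` that contains `B`. Thus each vertex has
one neighbour in the direction of the distinguished end (`l → -∞`), and its other neighbours
correspond to the classes of `𝓞_K` modulo `x`. For a prime `𝔭`, balls in `K` correspond to the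
classes of lattices in `K²`, so that this is the subspace of points of equal height
in the product of the trees of the primes dividing `x`.

A point `(height, ball)` with `l < height ≤ l + 1` lies on the edge from a vertex `(l + 1, ball)`
towards the end, at distance `l + 1 - height` from that vertex. The number `height` is the value
of the Busemann function of the end. -/
@[ext] structure Tree where
  /-- the value of the Busemann function -/
  height : ℝ
  /-- the ball of level `⌈height⌉` -/
  ball : Set K
  isBall : ∃ a, ball = levelBall x a ⌈height⌉

variable {x}

/-- `p.OnRay q`: the point `q` lies on the ray from `p` to the distinguished end. -/
def Tree.OnRay (p q : Tree x) : Prop := q.height ≤ p.height ∧ p.ball ⊆ q.ball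

/-- The height of the point where the rays from `p` and `q` to the distinguished end meet. -/
def Tree.meet (p q : Tree x) : ℝ := sSup {h | ∃ r : Tree x, p.OnRay r ∧ q.OnRay r ∧ h = r.height}

theorem mem_levelBall_self (a : K) (l : ℤ) : a ∈ levelBall x a l := by
  intro 𝔭 _; simp

theorem levelBall_eq {a b : K} {l : ℤ} (h : b ∈ levelBall x a l) :
    levelBall x b l = levelBall x a l := by
  ext y
  refine forall_congr' fun 𝔭 => forall_congr' fun h𝔭 => ?_
  have hb := h 𝔭 h𝔭
  constructor
  · intro hy
    have := 𝔭.valuation K |>.map_add_le hy hb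
    simpa using this
  · intro hy
    have := 𝔭.valuation K |>.map_sub_le hy hb
    simpa using this

theorem levelBall_mono [NeZero x] (a : K) {l m : ℤ} (h : l ≤ m) :
    levelBall x a m ⊆ levelBall x a l := by
  intro y hy 𝔭 h𝔭
  refine (hy 𝔭 h𝔭).trans ?_
  have h1 : 𝔭.valuation K (x : K) ≤ 1 := 𝔭.valuation_le_one x
  have h0 : 0 < 𝔭.valuation K (x : K) := by
    rw [zero_lt_iff]; exact (Valuation.ne_zero_iff _).2 (coe_ne_zero x)
  exact zpow_le_zpow_right_of_le_one₀ h0 h1 h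

/-- The point of height `h` whose ball contains `a`. -/
def Tree.mk' (x : 𝓞 K) (h : ℝ) (a : K) : Tree x := ⟨h, levelBall x a ⌈h⌉, a, rfl⟩

theorem Tree.ball_eq (p : Tree x) {a : K} (ha : a ∈ p.ball) :
    p.ball = levelBall x a ⌈p.height⌉ := by
  obtain ⟨b, hb⟩ := p.isBall
  rw [hb] at ha ⊢
  exact (levelBall_eq ha).symm

theorem Tree.nonempty (p : Tree x) : p.ball.Nonempty := by
  obtain ⟨b, hb⟩ := p.isBall
  exact ⟨b, hb ▸ mem_levelBall_self b _⟩

theorem Tree.ext_of_mem {p q : Tree x} (h : p.height = q.height) {a : K} (hp : a ∈ p.ball)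
    (hq : a ∈ q.ball) : p = q := by
  refine Tree.ext h ?_
  rw [p.ball_eq hp, q.ball_eq hq, h]

theorem Tree.subset_of_mem [NeZero x] {p q : Tree x} (h : q.height ≤ p.height) {a : K}
    (hp : a ∈ p.ball) (hq : a ∈ q.ball) : p.ball ⊆ q.ball := by
  rw [p.ball_eq hp, q.ball_eq hq]
  exact levelBall_mono a (Int.ceil_mono h)

theorem Tree.onRay_refl (p : Tree x) : p.OnRay p := ⟨le_rfl, subset_rfl⟩

theorem Tree.OnRay.trans {p q r : Tree x} (h : p.OnRay q) (h' : q.OnRay r) : p.OnRay r :=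
  ⟨h'.1.trans h.1, h.2.trans h'.2⟩

theorem Tree.OnRay.of_le [NeZero x] {p q r : Tree x} (h : p.OnRay q) (h' : p.OnRay r)
    (hqr : r.height ≤ q.height) : q.OnRay r := by
  obtain ⟨a, ha⟩ := p.nonempty
  exact ⟨hqr, Tree.subset_of_mem hqr (h.2 ha) (h'.2 ha)⟩

theorem exists_mem_levelBall [NeZero x] (a b : K) : ∃ l₀ : ℤ, ∀ l ≤ l₀, b ∈ levelBall x a l := by
  have hx : Ideal.span {x} ≠ (0 : Ideal (𝓞 K)) := by
    simpa [Ideal.span_singleton_eq_bot] using NeZero.ne x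
  have hfin := Ideal.finite_factors hx
  have key : ∀ 𝔭 : HeightOneSpectrum (𝓞 K), 𝔭.asIdeal ∣ Ideal.span {x} →
      ∃ n : ℕ, 𝔭.valuation K (b - a) ≤ 𝔭.valuation K (x : K) ^ (-(n : ℤ)) := by
    intro 𝔭 h𝔭
    have h1 : 𝔭.valuation K (x : K) < 1 := (𝔭.valuation_lt_one_iff_dvd x).2 h𝔭
    have h0 : 𝔭.valuation K (x : K) ≠ 0 := (Valuation.ne_zero_iff _).2 (coe_ne_zero x)
    by_cases hb : 𝔭.valuation K (b - a) = 0
    · exact ⟨0, by simp [hb]⟩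
    obtain ⟨n, hn⟩ := exists_pow_lt₀ h1 (Units.mk0 _ (inv_ne_zero hb))
    refine ⟨n, ?_⟩
    rw [zpow_neg, zpow_natCast]
    rw [Units.val_mk0] at hn
    rw [le_inv_comm₀ (zero_lt_iff.2 hb) (pow_pos (zero_lt_iff.2 h0) n)]
    exact hn.le
  choose! n hn using key
  refine ⟨-((∑ 𝔭 ∈ hfin.toFinset, n 𝔭 : ℕ) : ℤ), fun l hl 𝔭 h𝔭 => (hn 𝔭 h𝔭).trans ?_⟩
  have h1 : 𝔭.valuation K (x : K) ≤ 1 := 𝔭.valuation_le_one x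
  have h0 : 0 < 𝔭.valuation K (x : K) := by
    rw [zero_lt_iff]; exact (Valuation.ne_zero_iff _).2 (coe_ne_zero x)
  refine zpow_le_zpow_right_of_le_one₀ h0 h1 (hl.trans ?_)
  have : n 𝔭 ≤ ∑ 𝔭 ∈ hfin.toFinset, n 𝔭 :=
    Finset.single_le_sum (f := n) (fun _ _ => Nat.zero_le _) (hfin.mem_toFinset.2 h𝔭)
  omega

theorem Tree.meetSet_nonempty [NeZero x] (p q : Tree x) :
    {h | ∃ r : Tree x, p.OnRay r ∧ q.OnRay r ∧ h = r.height}.Nonempty := by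
  obtain ⟨a, ha⟩ := p.nonempty
  obtain ⟨b, hb⟩ := q.nonempty
  obtain ⟨l₀, hl₀⟩ := exists_mem_levelBall (x := x) a b
  set t : ℝ := min (l₀ : ℝ) (min p.height q.height) with ht
  refine ⟨t, Tree.mk' x t a, ⟨?_, ?_⟩, ⟨?_, ?_⟩, rfl⟩
  · exact (min_le_right _ _).trans (min_le_left _ _)
  · exact Tree.subset_of_mem ((min_le_right _ _).trans (min_le_left _ _)) ha
      (mem_levelBall_self a _)
  · exact (min_le_right _ _).trans (min_le_right _ _)
  · refine Tree.subset_of_mem ((min_le_right _ _).trans (min_le_right _ _)) hb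
      (hl₀ _ (Int.ceil_le.2 (min_le_left _ _)))

theorem Tree.meetSet_bddAbove (p q : Tree x) :
    BddAbove {h | ∃ r : Tree x, p.OnRay r ∧ q.OnRay r ∧ h = r.height} :=
  ⟨p.height, by rintro _ ⟨r, hp, -, rfl⟩; exact hp.1⟩

theorem Tree.meet_comm (p q : Tree x) : p.meet q = q.meet p := by
  unfold Tree.meet; congr 1; ext h; constructor <;> rintro ⟨r, h1, h2, h3⟩ <;> exact ⟨r, h2, h1, h3⟩

theorem Tree.meet_le_left [NeZero x] (p q : Tree x) : p.meet q ≤ p.height :=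
  csSup_le (Tree.meetSet_nonempty p q) (by rintro _ ⟨r, hp, -, rfl⟩; exact hp.1)

theorem Tree.meet_self (p : Tree x) : p.meet p = p.height :=
  le_antisymm (csSup_le ⟨_, p, p.onRay_refl, p.onRay_refl, rfl⟩
    (by rintro _ ⟨r, hp, -, rfl⟩; exact hp.1))
    (le_csSup (Tree.meetSet_bddAbove p p) ⟨p, p.onRay_refl, p.onRay_refl, rfl⟩)

theorem Tree.meet_add_le [NeZero x] (p q r : Tree x) :
    p.meet r + r.meet q ≤ r.height + p.meet q := by
  suffices h : ∀ s t : Tree x, p.OnRay s → r.OnRay s → r.OnRay t → q.OnRay t →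
      s.height + t.height ≤ r.height + p.meet q by
    have h1 : ∀ t : Tree x, r.OnRay t → q.OnRay t →
        p.meet r ≤ r.height + p.meet q - t.height := by
      intro t hrt hqt
      refine csSup_le (Tree.meetSet_nonempty p r) ?_
      rintro _ ⟨s, hps, hrs, rfl⟩
      linarith [h s t hps hrs hrt hqt]
    have h2 : r.meet q ≤ r.height + p.meet q - p.meet r := by
      refine csSup_le (Tree.meetSet_nonempty r q) ?_
      rintro _ ⟨t, hrt, hqt, rfl⟩
      linarith [h1 t hrt hqt]
    linarith
  intro s t hps hrs hrt hqt
  rcases le_total s.height t.height with hst | hst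
  · have : s.height ≤ p.meet q :=
      le_csSup (Tree.meetSet_bddAbove p q) ⟨s, hps, hqt.trans (hrt.of_le hrs hst), rfl⟩
    linarith [hrt.1]
  · have : t.height ≤ p.meet q :=
      le_csSup (Tree.meetSet_bddAbove p q) ⟨t, hps.trans (hrs.of_le hrt hst), hqt, rfl⟩
    linarith [hrs.1]

/-- The path metric of the tree: a geodesic from `p` to `q` first follows the ray from `p` to the
distinguished end, up to the point where it meets the ray from `q`. -/
instance [NeZero x] : MetricSpace (Tree x) where
  dist p q := p.height + q.height - 2 * p.meet q
  dist_self p := by rw [Tree.meet_self]; ring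
  dist_comm p q := by rw [Tree.meet_comm]; ring
  dist_triangle p r q := by
    have := Tree.meet_add_le p q r
    linarith
  eq_of_dist_eq_zero := by
    intro p q h
    have h1 := Tree.meet_le_left p q
    have h2 := Tree.meet_le_left q p
    rw [Tree.meet_comm] at h2
    have hpq : p.height = q.height := by linarith
    have hm : p.height = p.meet q := by linarith
    obtain ⟨_, ⟨r, hpr, hqr, rfl⟩, hr⟩ := exists_lt_of_lt_csSup (Tree.meetSet_nonempty p q)
      (b := (⌈p.height⌉ : ℝ) - 1) (by
        change _ < p.meet q
        rw [← hm]; linarith [Int.ceil_lt_add_one p.height])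
    have hc : ⌈r.height⌉ = ⌈p.height⌉ := by
      refine le_antisymm (Int.ceil_mono hpr.1) ?_
      have := Int.le_ceil r.height
      have h3 : ((⌈p.height⌉ - 1 : ℤ) : ℝ) < (⌈r.height⌉ : ℤ) := by push_cast; linarith
      have h4 := Int.cast_lt.1 h3
      omega
    obtain ⟨a, ha⟩ := p.nonempty
    obtain ⟨b, hb⟩ := q.nonempty
    refine Tree.ext hpq ?_
    rw [p.ball_eq ha, q.ball_eq hb, ← hpq, ← hc, ← r.ball_eq (hpr.2 ha), ← r.ball_eq (hqr.2 hb)]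

theorem Tree.dist_def [NeZero x] (p q : Tree x) :
    dist p q = p.height + q.height - 2 * p.meet q := rfl

variable [NeZero x]

theorem image_levelBall (g : Gamma x) (a : K) (l : ℤ) :
    (fun y => (x : K) ^ g.k * y + g.b) '' levelBall x a l
      = levelBall x ((x : K) ^ g.k * a + g.b) (l + g.k) := by
  have hx := coe_ne_zero x
  have hxk : (x : K) ^ g.k ≠ 0 := zpow_ne_zero _ hx
  have hv : ∀ (𝔭 : HeightOneSpectrum (𝓞 K)) (z : K),
      𝔭.valuation K ((x : K) ^ g.k * z) ≤ 𝔭.valuation K (x : K) ^ (l + g.k) ↔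
        𝔭.valuation K z ≤ 𝔭.valuation K (x : K) ^ l := by
    intro 𝔭 z
    have h0 : 0 < 𝔭.valuation K (x : K) := by
      rw [zero_lt_iff]; exact (Valuation.ne_zero_iff _).2 hx
    rw [map_mul, map_zpow₀, zpow_add₀ h0.ne', mul_comm]
    exact mul_le_mul_iff_left₀ (zpow_pos h0 _)
  ext y
  constructor
  · rintro ⟨z, hz, rfl⟩ 𝔭 h𝔭
    have := (hv 𝔭 (z - a)).2 (hz 𝔭 h𝔭)
    convert this using 2
    ring
  · intro hy
    refine ⟨((x : K) ^ g.k)⁻¹ * (y - g.b), fun 𝔭 h𝔭 => (hv 𝔭 _).1 ?_, ?_⟩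
    · convert hy 𝔭 h𝔭 using 2
      field_simp
      ring
    · field_simp
      ring

/-- The action of `Γ` on `T_d`: `(b, k) ∈ Γ` acts as the matrix `(xᵏ b; 0 1)`, that is, it moves
balls in `K` by `y ↦ xᵏ y + b` and raises heights by `k`. -/
instance : MulAction (Gamma x) (Tree x) where
  smul g p := ⟨p.height + g.k, (fun y => (x : K) ^ g.k * y + g.b) '' p.ball, by
    obtain ⟨a, ha⟩ := p.isBall
    exact ⟨(x : K) ^ g.k * a + g.b, by rw [ha, image_levelBall, Int.ceil_add_intCast]⟩⟩
  one_smul p := Tree.ext (by change p.height + _ = _; simp) (by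
    change (fun y => (x : K) ^ (1 : Gamma x).k * y + (1 : Gamma x).b) '' p.ball = _
    simp)
  mul_smul g h p := Tree.ext
    (by
      change p.height + ((g * h).k : ℝ) = p.height + (h.k : ℝ) + (g.k : ℝ)
      rw [Gamma.k_mul]; push_cast; ring)
    (by
      change (fun y => (x : K) ^ (g * h).k * y + (g * h).b) '' p.ball
        = (fun y => (x : K) ^ g.k * y + g.b) '' ((fun y => (x : K) ^ h.k * y + h.b) '' p.ball)
      rw [Set.image_image]
      refine Set.image_congr fun y _ => ?_
      rw [Gamma.k_mul, Gamma.b_mul, zpow_add₀ (coe_ne_zero x)]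
      ring)

theorem Tree.smul_height (g : Gamma x) (p : Tree x) : (g • p).height = p.height + g.k := rfl

theorem Tree.smul_ball (g : Gamma x) (p : Tree x) :
    (g • p).ball = (fun y => (x : K) ^ g.k * y + g.b) '' p.ball := rfl

theorem Tree.OnRay.smul {p q : Tree x} (h : p.OnRay q) (g : Gamma x) : (g • p).OnRay (g • q) :=
  ⟨by rw [Tree.smul_height, Tree.smul_height]; linarith [h.1], Set.image_mono h.2⟩

theorem Tree.meet_smul_le (g : Gamma x) (p q : Tree x) :
    p.meet q + g.k ≤ (g • p).meet (g • q) := by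
  rw [← le_sub_iff_add_le]
  refine csSup_le (Tree.meetSet_nonempty p q) ?_
  rintro _ ⟨r, hp, hq, rfl⟩
  rw [le_sub_iff_add_le]
  exact le_csSup (Tree.meetSet_bddAbove _ _) ⟨g • r, hp.smul g, hq.smul g, rfl⟩

instance : IsIsometricSMul (Gamma x) (Tree x) where
  isometry_smul g := Isometry.of_dist_eq fun p q => by
    have h1 := Tree.meet_smul_le g p q
    have h2 := Tree.meet_smul_le g⁻¹ (g • p) (g • q)
    have h3 : (g⁻¹).k = -g.k := by
      have := Gamma.k_mul g⁻¹ g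
      rw [inv_mul_cancel, Gamma.k_one] at this
      omega
    rw [inv_smul_smul, inv_smul_smul, h3] at h2
    push_cast at h2
    rw [Tree.dist_def, Tree.dist_def, Tree.smul_height, Tree.smul_height]
    linarith

end Tree

/-! ### The affine action of `Γ` on `ℝⁿ` -/

section Euclidean

set_option linter.unusedSectionVars false

variable {K : Type*} [Field K] [NumberField K] {ι : Type*} [Fintype ι] [DecidableEq ι]

/-- `ℝⁿ` with coordinates indexed by a `ℤ`-basis `e` of `𝓞_K`. -/
def RSpace (_e : Basis ι ℤ (𝓞 K)) : Type _ := ι → ℝ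

instance (e : Basis ι ℤ (𝓞 K)) : TopologicalSpace (RSpace e) :=
  inferInstanceAs (TopologicalSpace (ι → ℝ))

/-- The matrix `A_x` of multiplication by `x` on `𝓞_K` with respect to the basis `e`, acting on row
vectors: `x eᵢ = ∑ⱼ (A_x)ᵢⱼ eⱼ`. -/
def xMatrix (e : Basis ι ℤ (𝓞 K)) (x : 𝓞 K) : Matrix ι ι ℝ :=
  Matrix.of fun i j => ((e.repr (x * e i) j : ℤ) : ℝ)

/-- The vector of coordinates of `b ∈ K` with respect to the basis `e`. -/
def coords (e : Basis ι ℤ (𝓞 K)) (b : K) : ι → ℝ :=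
  fun i => (((e.localizationLocalization ℚ (nonZeroDivisors ℤ) K).repr b i : ℚ) : ℝ)

theorem coords_add (e : Basis ι ℤ (𝓞 K)) (b c : K) :
    coords e (b + c) = coords e b + coords e c := by
  ext i; simp [coords]

theorem coords_zero (e : Basis ι ℤ (𝓞 K)) : coords e (0 : K) = 0 := by
  ext i; simp [coords]

theorem isUnit_det_xMatrix (e : Basis ι ℤ (𝓞 K)) (x : 𝓞 K) [NeZero x] :
    IsUnit (xMatrix e x).det := by
  have h : xMatrix e x = ((Algebra.leftMulMatrix e x).map (Int.castRingHom ℝ))ᵀ := by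
    ext i j; simp [xMatrix, Algebra.leftMulMatrix_eq_repr_mul]
  rw [h, Matrix.det_transpose, isUnit_iff_ne_zero]
  have h2 := RingHom.map_det (Int.castRingHom ℝ) (Algebra.leftMulMatrix e x)
  rw [RingHom.mapMatrix_apply] at h2
  rw [← h2, ← Algebra.norm_eq_matrix_det]
  have h3 : Algebra.norm ℤ x ≠ 0 := Algebra.norm_ne_zero_iff.2 (NeZero.ne x)
  simpa using h3

theorem coords_mul (e : Basis ι ℤ (𝓞 K)) (x : 𝓞 K) (b : K) :
    coords e ((x : K) * b) = coords e b ᵥ* xMatrix e x := by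
  set E := e.localizationLocalization ℚ (nonZeroDivisors ℤ) K with hE
  have hE1 : ∀ i, E i = algebraMap (𝓞 K) K (e i) := fun i =>
    Basis.localizationLocalization_apply ℚ (nonZeroDivisors ℤ) K e i
  have hE2 : ∀ (y : 𝓞 K) i, E.repr (algebraMap (𝓞 K) K y) i = ((e.repr y i : ℤ) : ℚ) := fun y i =>
    Basis.localizationLocalization_repr_algebraMap ℚ (nonZeroDivisors ℤ) K e y i
  ext j
  have h1 : E.repr ((x : K) * b) j = ∑ i, E.repr b i * ((e.repr (x * e i) j : ℤ) : ℚ) := by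
    conv_lhs => rw [← E.sum_repr b, Finset.mul_sum]
    rw [map_sum, Finset.sum_apply']
    refine Finset.sum_congr rfl fun i _ => ?_
    have h2 : (x : K) * E i = algebraMap (𝓞 K) K (x * e i) := by rw [hE1, map_mul]
    rw [mul_smul_comm, h2, map_smul, Finsupp.smul_apply, hE2, smul_eq_mul]
  simp only [coords, Matrix.vecMul, dotProduct, xMatrix, Matrix.of_apply]
  rw [← hE, h1]
  push_cast
  rfl

theorem coords_zpow_mul (e : Basis ι ℤ (𝓞 K)) (x : 𝓞 K) [NeZero x] (k : ℤ) (b : K) :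
    coords e ((x : K) ^ k * b) = coords e b ᵥ* (xMatrix e x ^ k) := by
  have hu := isUnit_det_xMatrix e x
  have hx := coe_ne_zero x
  induction k with
  | zero => simp
  | succ n ih =>
    rw [zpow_add_one₀ hx, mul_comm ((x : K) ^ (n : ℤ)), mul_assoc, coords_mul, ih,
      Matrix.vecMul_vecMul, Matrix.zpow_add_one hu]
  | pred n ih =>
    have h := coords_mul e x ((x : K) ^ (-(n : ℤ) - 1) * b)
    rw [← mul_assoc, ← zpow_one_add₀ hx, add_sub_cancel, ih] at h
    rw [Matrix.zpow_sub_one hu, ← Matrix.vecMul_vecMul, h, Matrix.vecMul_vecMul,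
      Matrix.mul_nonsing_inv _ hu, Matrix.vecMul_one]

/-- The affine action of `Γ` on `ℝⁿ`: `(b, k) w = w A_xᵏ + (b₁, …, bₙ)`. -/
def affineMap (e : Basis ι ℤ (𝓞 K)) {x : 𝓞 K} [NeZero x] (g : Gamma x) (w : ι → ℝ) : ι → ℝ :=
  w ᵥ* (xMatrix e x ^ g.k) + coords e g.b

theorem affineMap_one (e : Basis ι ℤ (𝓞 K)) {x : 𝓞 K} [NeZero x] (w : ι → ℝ) :
    affineMap e (1 : Gamma x) w = w := by
  simp [affineMap, coords_zero]

theorem affineMap_mul (e : Basis ι ℤ (𝓞 K)) {x : 𝓞 K} [NeZero x] (g h : Gamma x) (w : ι → ℝ) :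
    affineMap e (g * h) w = affineMap e g (affineMap e h w) := by
  unfold affineMap
  rw [Gamma.k_mul, Gamma.b_mul, coords_add, coords_zpow_mul, Matrix.add_vecMul,
    Matrix.vecMul_vecMul, add_comm g.k, Matrix.zpow_add (isUnit_det_xMatrix e x)]
  abel

instance (e : Basis ι ℤ (𝓞 K)) (x : 𝓞 K) [NeZero x] : MulAction (Gamma x) (RSpace e) where
  smul g w := affineMap e g w
  one_smul w := affineMap_one e w
  mul_smul g h w := affineMap_mul e g h w

instance (e : Basis ι ℤ (𝓞 K)) (x : 𝓞 K) [NeZero x] :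
    ContinuousConstSMul (Gamma x) (RSpace e) where
  continuous_const_smul g := by
    change Continuous fun w : ι → ℝ => w ᵥ* (xMatrix e x ^ g.k) + coords e g.b
    fun_prop

end Euclidean

/-! ### The horizontal flow space -/

section HFS

variable {K : Type*} [Field K] [NumberField K] {ι : Type*} [Fintype ι] [DecidableEq ι]
variable (x : 𝓞 K) [NeZero x] (e : Basis ι ℤ (𝓞 K))

/-- The horizontal flow space `HFS(T_d × ℝⁿ) = FS(T_d) × ℝⁿ`, with the product topology and the
diagonal action of `Γ` (by homeomorphisms). -/
abbrev HFS : Type _ := FS (Tree x) × RSpace e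

instance : ContinuousConstSMul (Gamma x) (HFS x e) := inferInstance

variable {x e}

/-- The flow `Φ_τ(c, w) = (c(· + τ), w)`. -/
def HFS.flow (τ : ℝ) (p : HFS x e) : HFS x e := (FS.flow τ p.1, p.2)

/-- The flow line through `p`. -/
def HFS.flowLine (p : HFS x e) : Set (HFS x e) := Set.range fun τ : ℝ => HFS.flow τ p

/-- The `Γ`-period of `p` (or of the flow line through `p`), that is, its period in `Γ \ HFS`:
the infimum of the `τ > 0` such that `Φ_τ(p) = g p` for some `g ∈ Γ`; it is `∞` if there are none. -/
def HFS.period (p : HFS x e) : ℝ≥0∞ :=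
  sInf {s | ∃ τ : ℝ, 0 < τ ∧ (∃ g : Gamma x, HFS.flow τ p = g • p) ∧ s = ENNReal.ofReal τ}

variable (x e) in
/-- The set of points that are fixed by the flow. -/
def HFS.fixedSet : Set (HFS x e) := {p | ∀ τ : ℝ, HFS.flow τ p = p}

end HFS

/-! ### General notions -/

/-- Every point has an open neighbourhood `U` such that `g U ∩ U ≠ ∅` for only finitely many `g`. -/
def ActsProperly (G X : Type*) [Group G] [TopologicalSpace X] [MulAction G X] : Prop :=
  ∀ p : X, ∃ U : Set X, IsOpen U ∧ p ∈ U ∧ {g : G | (g • U ∩ U).Nonempty}.Finite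

/-- There is a compact set whose translates cover the space. -/
def ActsCocompactly (G X : Type*) [Group G] [TopologicalSpace X] [MulAction G X] : Prop :=
  ∃ C : Set X, IsCompact C ∧ ⋃ g : G, g • C = Set.univ

/-- The covering dimension of `X` is at most `n`: every open cover of `X` has an open refinement
such that every point lies in at most `n + 1` of its members. -/
def CoveringDimLE (X : Type*) [TopologicalSpace X] (n : ℕ) : Prop :=
  ∀ 𝒰 : Set (Set X), (∀ U ∈ 𝒰, IsOpen U) → ⋃₀ 𝒰 = Set.univ →
    ∃ 𝒱 : Set (Set X), (∀ V ∈ 𝒱, IsOpen V) ∧ ⋃₀ 𝒱 = Set.univ ∧ (∀ V ∈ 𝒱, ∃ U ∈ 𝒰, V ⊆ U) ∧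
      ∀ p : X, {V | V ∈ 𝒱 ∧ p ∈ V}.encard ≤ n + 1

/-- The covering dimension of a nonempty space. -/
def coveringDim (X : Type*) [TopologicalSpace X] : ℕ∞ :=
  sInf {m | ∃ n : ℕ, CoveringDimLE X n ∧ m = n}

/-- The supremum `k_G` of the orders of the finite subgroups of `G`. -/
def finiteSubgroupBound (G : Type*) [Group G] : ℕ∞ :=
  sSup {m | ∃ H : Subgroup G, Finite H ∧ m = (Nat.card H : ℕ∞)}

end HorizontalFlow

end

/-! Generalized geodesics have speed at most one. Hence the integral metric on `FS` induces uniform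
convergence on compact intervals, and values at rational times already determine the topology
(`FS.isInducing_eval`). The tree is studied through heights and the heights at which rays to the
distinguished end meet. Meeting heights satisfy an ultrametric inequality (`Tree.min_meet_le`),
which makes the tree 0-hyperbolic (`Tree.fourPoint`); finiteness of the residue rings modulo powers
of `x` makes it proper.

(i) An element of `𝓞_K[1/x]` with bounded denominators at the primes dividing `x` lies in some `x⁻ᵐ
𝓞_K`, a lattice in `ℝⁿ`. So bounding both the displacement in the tree and that in `ℝⁿ` leaves
finitely many elements of `Γ` (`finite_setOf_gamma`). Conversely `𝓞_K[1/x]` is dense in `K` for the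
balls, so `c(0)` can be moved into a fixed edge, and the translations by `x 𝓞_K` that remain act
cocompactly on `ℝⁿ`. An Arzelà–Ascoli argument (`FS.isCompact_eval_zero`) shows that controlling
`c(0)` suffices.

(ii) If `g = (b, k)` realizes a finite positive period, then `k ≠ 0`. Such a `g` has a unique fixed
point `β = b / (1 - xᵏ)` in `K`, because `x` is not a root of unity. A flow line translated by `g`
must be the vertical line to `β` paired with the coordinates of `β`
(`exists_verticalPoint_of_period`). Since `|k|` is bounded by the period and `β` matters only modulo
`𝓞_K[1/x]`, finitely many orbits remain.

(iii) A geodesic close to a non-constant `c` agrees with a shift of `c` on a core interval. It can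
be shortened to the core, slid along `c`, and lengthened again to `c` without leaving a small ball
(`FourPoint.exists_isPreconnected_nhds`).

(iv) `Γ` is torsion free. For the dimension, the heights of a geodesic at rational times fall into
at most four classes modulo `ℚ`. Thus the pairs all of whose heights and coordinates avoid one of
the `n + 5` dense sets `i √2 + ℚ` cover `HFS`, and each of these pieces is zero-dimensional
(`coveringDimLE_subtype_HFS`). -/

namespace HorizontalFlow

/-! ### Topology of the flow space -/

section FlowSpaceMetric

open Filter Topology

variable {X : Type*} [MetricSpace X]

theorem integrable_weight : Integrable fun t : ℝ => (1 + t ^ 2) / (2 * Real.exp |t|) := by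
  -- The exponential series gives `(1 + t²)² = 1 + 2t² + t⁴ ≤ (1 + 4 + 24) e^|t|`.
  refine Integrable.mono' (integrable_inv_one_add_sq.const_mul 29) ?_ ?_
  · refine Continuous.aestronglyMeasurable (Continuous.div (by fun_prop) (by fun_prop) ?_)
    intro t; positivity
  · refine Eventually.of_forall fun t => ?_
    rw [Real.norm_of_nonneg (by positivity), div_le_iff₀ (by positivity), ← div_eq_mul_inv,
      div_mul_eq_mul_div, le_div_iff₀ (by positivity)]
    have e0 := Real.one_le_exp (abs_nonneg t)
    have e2 := Real.pow_div_factorial_le_exp |t| (abs_nonneg t) 2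
    have e4 := Real.pow_div_factorial_le_exp |t| (abs_nonneg t) 4
    norm_num [Nat.factorial] at e2 e4
    have h4 : |t| ^ 4 = t ^ 4 := by rw [show (4 : ℕ) = 2 * 2 from rfl, pow_mul, sq_abs]; ring
    rw [h4] at e4
    nlinarith

/-- The total mass of `(1 + t²) / (2 e^|t|)`. -/
noncomputable def weightMass : ℝ := ∫ t : ℝ, (1 + t ^ 2) / (2 * Real.exp |t|)

theorem weightMass_nonneg : 0 ≤ weightMass := integral_nonneg fun t => by positivity

theorem FS.dist_le_of_forall {c d : FS X} {η : ℝ}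
    (h : ∀ t, dist (c.1 t) (d.1 t) ≤ η * (1 + t ^ 2)) : dist c d ≤ η * weightMass := by
  rw [FS.dist_def, weightMass, ← integral_const_mul]
  refine integral_mono (c.integrable d) (integrable_weight.const_mul η) fun t => ?_
  beta_reduce
  rw [← mul_div_assoc]
  gcongr
  exact h t

/-- Outside `[-R, R]` the two geodesics separate with speed at most two, and `2 |t| ≤ (2 / R) t²`
there. The weight `1 + t²` therefore absorbs the tails and the closeness on the window at once. -/
theorem FS.dist_le_of_abs_le {c d : FS X} {R η : ℝ} (hR : 0 < R) (hη : 0 ≤ η)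
    (h : ∀ t, |t| ≤ R → dist (c.1 t) (d.1 t) ≤ η) : dist c d ≤ (η + 2 / R) * weightMass := by
  refine FS.dist_le_of_forall fun t => ?_
  have h0 : η ≤ (η + 2 / R) * (1 + t ^ 2) := by
    have : 0 ≤ 2 / R := by positivity
    nlinarith [mul_nonneg hη (sq_nonneg t), mul_nonneg this (sq_nonneg t)]
  rcases le_total |t| R with ht | ht
  · exact (h t ht).trans h0
  · have key : ∀ s : ℝ, |s| = R → |t - s| = |t| - R →
        dist (c.1 t) (d.1 t) ≤ (η + 2 / R) * (1 + t ^ 2) := by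
      intro s hs hts
      have h1 := c.2.dist_le t s
      have h2 := d.2.dist_le s t
      have h3 := h s hs.le
      have h4 := dist_triangle4 (c.1 t) (c.1 s) (d.1 s) (d.1 t)
      rw [hts] at h1
      rw [abs_sub_comm, hts] at h2
      have h5 : |t| ≤ t ^ 2 / R := by
        rw [le_div_iff₀ hR, ← sq_abs, sq]; exact mul_le_mul_of_nonneg_left ht (abs_nonneg t)
      have h6 : (η + 2 / R) * (1 + t ^ 2) = η + 2 / R + η * t ^ 2 + 2 * (t ^ 2 / R) := by ring
      have : 0 ≤ 2 / R := by positivity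
      nlinarith [mul_nonneg hη (sq_nonneg t)]
    rcases le_total 0 t with h0 | h0
    · refine key R (abs_of_pos hR) ?_
      rw [abs_of_nonneg h0] at ht ⊢
      exact abs_of_nonneg (sub_nonneg.2 ht)
    · refine key (-R) (by rw [abs_neg, abs_of_pos hR]) ?_
      rw [abs_of_nonpos h0] at ht ⊢
      rw [abs_of_nonpos (by linarith)]; ring

variable (X) in
theorem FS.exists_dist_lt {ε : ℝ} (hε : 0 < ε) (R₀ : ℝ) : ∃ R η : ℝ, 0 < R ∧ R₀ ≤ R ∧ 0 < η ∧
    ∀ c d : FS X, (∀ t, |t| ≤ R → dist (c.1 t) (d.1 t) ≤ η) → dist c d < ε := by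
  have hM := weightMass_nonneg
  set M := weightMass + 1 with hMdef
  have hM1 : 0 < M := by positivity
  refine ⟨max R₀ (4 * M / ε), ε / (4 * M), lt_max_of_lt_right (by positivity), le_max_left _ _,
    by positivity, fun c d h => ?_⟩
  have hR : 0 < max R₀ (4 * M / ε) := lt_max_of_lt_right (by positivity)
  refine (FS.dist_le_of_abs_le hR (by positivity) h).trans_lt ?_
  have h1 : 2 / max R₀ (4 * M / ε) ≤ 2 / (4 * M / ε) := by
    gcongr; exact le_max_right _ _
  have h2 : 2 / (4 * M / ε) = 2 * (ε / (4 * M)) := by field_simp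
  have h3 : ε / (4 * M) * M = ε / 4 := by field_simp
  have h4 : 0 < ε / (4 * M) := by positivity
  calc _ ≤ (3 * (ε / (4 * M))) * M := by
        refine mul_le_mul ?_ (by linarith) hM (by positivity)
        linarith
    _ < ε := by linarith

variable (X) in
-- Converse to `FS.exists_dist_lt`: a gap of `η` at one time persists, by the Lipschitz bound, over
-- a short interval and so contributes a definite amount to the integral.
theorem FS.exists_eval_lt (R : ℝ) {η : ℝ} (hη : 0 < η) : ∃ δ : ℝ, 0 < δ ∧
    ∀ c d : FS X, dist c d < δ → ∀ t, |t| ≤ R → dist (c.1 t) (d.1 t) < η := by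
  -- During a time `η / 4` each geodesic moves by at most `η / 4`, so the gap remains at least `η /
  -- 2`, while the weight is bounded below through `|t| ≤ R + η`.
  refine ⟨η / 4 * (η / 2 / (2 * Real.exp (R + η))), by positivity, fun c d h t₀ ht₀ => ?_⟩
  by_contra! hcon
  refine absurd h (not_lt.2 ?_)
  rw [FS.dist_def]
  have h1 : ∫ t in Set.Icc t₀ (t₀ + η / 4), η / 2 / (2 * Real.exp (R + η)) =
      η / 4 * (η / 2 / (2 * Real.exp (R + η))) := by
    rw [setIntegral_const]
    have : 0 ≤ η / 4 := by positivity
    simp [Measure.real, this]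
  rw [← h1]
  refine le_trans ?_ (setIntegral_le_integral (s := Set.Icc t₀ (t₀ + η / 4)) (c.integrable d)
    (Eventually.of_forall fun t => by positivity))
  refine setIntegral_mono_on (by simp) (c.integrable d).integrableOn measurableSet_Icc ?_
  intro t ht
  have ha := c.2.dist_le t₀ t
  have hb := d.2.dist_le t t₀
  have hc := dist_triangle4 (c.1 t₀) (c.1 t) (d.1 t) (d.1 t₀)
  have hd : |t - t₀| ≤ η / 4 := by rw [abs_of_nonneg (by linarith [ht.1])]; linarith [ht.2]
  rw [abs_sub_comm] at ha
  have he : |t| ≤ R + η := by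
    have := abs_add_le t₀ (t - t₀)
    rw [add_sub_cancel] at this
    linarith
  gcongr
  linarith

theorem FS.continuous_eval (t : ℝ) : Continuous fun c : FS X => c.1 t := by
  refine Metric.continuous_iff.2 fun c ε hε => ?_
  obtain ⟨δ, hδ, h⟩ := FS.exists_eval_lt X |t| hε
  exact ⟨δ, hδ, fun d hd => h d c hd t le_rfl⟩

variable (X) in
theorem FS.exists_finset_dist_lt {ε : ℝ} (hε : 0 < ε) : ∃ F : Finset ℚ, ∃ δ : ℝ, 0 < δ ∧
    ∀ c d : FS X, (∀ q ∈ F, dist (c.1 q) (d.1 q) < δ) → dist c d < ε := by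
  obtain ⟨R, η, hR, -, hη, h⟩ := FS.exists_dist_lt X hε 0
  obtain ⟨F, hF⟩ := (isCompact_Icc (a := -R) (b := R)).elim_finite_subcover
    (fun q : ℚ => Metric.ball (q : ℝ) (η / 4)) (fun _ => Metric.isOpen_ball) (by
      intro t _
      obtain ⟨q, hq⟩ := Rat.isDenseEmbedding_coe_real.dense.exists_dist_lt t
        (ε := η / 4) (by positivity)
      exact Set.mem_iUnion.2 ⟨q, hq⟩)
  refine ⟨F, η / 2, by positivity, fun c d hcd => h c d fun t ht => ?_⟩
  obtain ⟨q, hq⟩ := Set.mem_iUnion.1 (hF (abs_le.1 ht))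
  obtain ⟨hqF, hq⟩ := Set.mem_iUnion.1 hq
  rw [Metric.mem_ball, Real.dist_eq] at hq
  have h1 := c.2.dist_le t q
  have h2 := d.2.dist_le q t
  rw [abs_sub_comm] at h2
  have h3 := dist_triangle4 (c.1 t) (c.1 q) (d.1 q) (d.1 t)
  linarith [hcd q hqF]

/-- For uniformly Lipschitz maps, pointwise convergence at rational times is convergence on compact
intervals. Compactness, second countability and the dimension bound are all read off from this map
to a countable product. -/
theorem FS.isInducing_eval : IsInducing fun (c : FS X) (q : ℚ) => c.1 q := by
  rw [isInducing_iff_nhds]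
  intro c
  refine le_antisymm ?_ ?_
  · exact (continuous_pi fun q : ℚ => FS.continuous_eval (q : ℝ)).continuousAt.tendsto.le_comap
  · refine Metric.nhds_basis_ball.ge_iff.2 fun ε hε => ?_
    obtain ⟨F, δ, hδ, h⟩ := FS.exists_finset_dist_lt X hε
    refine mem_comap.2 ⟨(F : Set ℚ).pi fun q => Metric.ball (c.1 q) δ,
      set_pi_mem_nhds F.finite_toSet fun q _ => Metric.ball_mem_nhds _ hδ, fun d hd => ?_⟩
    exact h d c fun q hq => hd q hq

theorem isGeneralizedGeodesic_const (p : X) : IsGeneralizedGeodesic fun _ : ℝ => p := by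
  have h : IsEmpty ↥(eInterval 0 0) := ⟨fun t => lt_asymm t.2.1 t.2.2⟩
  exact ⟨continuous_const, 0, 0, le_rfl, by simp, by simp, IsLocallyConstant.const p,
    fun s => h.elim s⟩

/-- A criterion that survives limits: the conditions are required only strictly away from the end
points, continuity supplies the boundary cases, and the end points excluded in the definition give
constant maps. -/
theorem isGeneralizedGeodesic_of_bounds {c : ℝ → X} (hc : Continuous c) (a b : EReal) (hab : a ≤ b)
    (h1 : ∀ s t : ℝ, s ≤ t → (t : EReal) < a → c s = c t)
    (h2 : ∀ s t : ℝ, s ≤ t → b < (s : EReal) → c s = c t)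
    (h3 : ∀ s t : ℝ, a < s → s ≤ t → (t : EReal) < b → dist (c s) (c t) = t - s) :
    IsGeneralizedGeodesic c := by
  have const_of : (∀ s t : ℝ, s ≤ t → c s = c t) → IsGeneralizedGeodesic c := by
    intro h
    have : c = fun _ => c 0 := by
      ext t
      rcases le_total t 0 with h0 | h0
      exacts [h _ _ h0, (h _ _ h0).symm]
    rw [this]
    exact isGeneralizedGeodesic_const _
  by_cases ha : a = ⊤
  · exact const_of fun s t hst => h1 s t hst (ha ▸ EReal.coe_lt_top t)
  by_cases hb : b = ⊥
  · exact const_of fun s t hst => h2 s t hst (hb ▸ EReal.bot_lt_coe s)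
  have h1' : ∀ s t : ℝ, s ≤ t → (t : EReal) ≤ a → c s = c t := by
    intro s t hst hta
    rcases hst.eq_or_lt with rfl | hlt
    · rfl
    have hcl : IsClosed {u : ℝ | c s = c u} := isClosed_eq continuous_const hc
    have hsub : Set.Ioo s t ⊆ {u : ℝ | c s = c u} := fun u hu =>
      h1 s u hu.1.le ((EReal.coe_lt_coe_iff.2 hu.2).trans_le hta)
    have := closure_minimal hsub hcl
    rw [closure_Ioo hlt.ne] at this
    exact this ⟨hst, le_rfl⟩
  have h2' : ∀ s t : ℝ, s ≤ t → b ≤ (s : EReal) → c s = c t := by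
    intro s t hst hta
    rcases hst.eq_or_lt with rfl | hlt
    · rfl
    have hcl : IsClosed {u : ℝ | c u = c t} := isClosed_eq hc continuous_const
    have hsub : Set.Ioo s t ⊆ {u : ℝ | c u = c t} := fun u hu =>
      h2 u t hu.2.le (hta.trans_lt (EReal.coe_lt_coe_iff.2 hu.1))
    have := closure_minimal hsub hcl
    rw [closure_Ioo hlt.ne] at this
    exact this ⟨le_rfl, hst⟩
  rcases hab.eq_or_lt with rfl | hlt
  · obtain ⟨r, rfl⟩ : ∃ r : ℝ, (r : EReal) = a := ⟨a.toReal, EReal.coe_toReal ha hb⟩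
    refine const_of fun s t _ => ?_
    have h : ∀ s, c s = c r := fun s => by
      rcases le_total s r with h | h
      exacts [h1' s r h le_rfl, (h2' r s h le_rfl).symm]
    rw [h s, h t]
  refine ⟨hc, a, b, hab, ha, hb, ?_, ?_⟩
  · rw [IsLocallyConstant.iff_eventually_eq]
    rintro ⟨t, ht⟩
    have ht' : (t : EReal) ≤ a ∨ b ≤ (t : EReal) := by
      by_contra! hcon
      exact ht ⟨hcon.1, hcon.2⟩
    have hcoe : Continuous fun s : ↥(eInterval a b)ᶜ => ((s : ℝ) : EReal) :=
      continuous_coe_real_ereal.comp continuous_subtype_val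
    rcases ht' with ht' | ht'
    · filter_upwards [hcoe.continuousAt.eventually_lt_const (ht'.trans_lt hlt)] with s hs
      have hs' : (s : EReal) ≤ a := by
        by_contra! hcon
        exact s.2 ⟨hcon, hs⟩
      rcases le_total (s : ℝ) t with h | h
      exacts [h1' _ _ h ht', (h1' _ _ h hs').symm]
    · filter_upwards [hcoe.continuousAt.eventually_const_lt (hlt.trans_le ht')] with s hs
      have hs' : b ≤ (s : EReal) := by
        by_contra! hcon
        exact s.2 ⟨hs, hcon⟩
      rcases le_total (s : ℝ) t with h | h
      exacts [h2' _ _ h hs', (h2' _ _ h ht').symm]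
  · refine Isometry.of_dist_eq ?_
    rintro ⟨s, hs⟩ ⟨t, ht⟩
    change dist (c s) (c t) = dist s t
    rw [Real.dist_eq]
    rcases le_total s t with h | h
    · rw [h3 s t hs.1 h ht.2, abs_sub_comm, abs_of_nonneg (sub_nonneg.2 h)]
    · rw [dist_comm, h3 t s ht.1 h hs.2, abs_of_nonneg (sub_nonneg.2 h)]

theorem IsGeneralizedGeodesic.exists_bounds {c : ℝ → X} (hc : IsGeneralizedGeodesic c) :
    ∃ a b : EReal, a ≤ b ∧ a ≠ ⊤ ∧ b ≠ ⊥ ∧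
      (∀ s t : ℝ, s ≤ t → (t : EReal) ≤ a → c s = c t) ∧
      (∀ s t : ℝ, s ≤ t → b ≤ (s : EReal) → c s = c t) ∧
      (∀ s t : ℝ, a < s → s ≤ t → (t : EReal) < b → dist (c s) (c t) = t - s) := by
  obtain ⟨-, a, b, hab, ha, hb, hl, hi⟩ := hc
  refine ⟨a, b, hab, ha, hb, fun s t hst ht => ?_, fun s t hst hs => ?_, fun s t hs hst ht => ?_⟩
  · exact locConst_apply_eq hl hst fun u hu hu' =>
      absurd hu'.1 (not_lt.2 ((EReal.coe_le_coe_iff.2 hu.2).trans ht))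
  · exact locConst_apply_eq hl hst fun u hu hu' =>
      absurd hu'.2 (not_lt.2 (hs.trans (EReal.coe_le_coe_iff.2 hu.1)))
  · have hs' : s ∈ eInterval a b := ⟨hs, (EReal.coe_le_coe_iff.2 hst).trans_lt ht⟩
    have ht' : t ∈ eInterval a b := ⟨hs.trans_le (EReal.coe_le_coe_iff.2 hst), ht⟩
    have := hi.dist_eq ⟨s, hs'⟩ ⟨t, ht'⟩
    refine this.trans ?_
    rw [Subtype.dist_eq, Real.dist_eq, abs_sub_comm, abs_of_nonneg (sub_nonneg.2 hst)]

/-- A generalized geodesic, stopped outside the time interval `[u, v]`. -/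
def FS.truncate (u v : ℝ) (c : FS X) : FS X := ⟨fun t => c.1 (max u (min v t)), by
  obtain ⟨a, b, hab, -, -, h1, h2, h3⟩ := c.2.exists_bounds
  -- The outer `max` keeps the end points in order even if the window `[u, v]` is empty or misses
  -- the moving part of `c`.
  refine isGeneralizedGeodesic_of_bounds (c.2.1.comp (by fun_prop)) (max a u)
    (max (max a u) (min b v)) (le_max_left _ _) ?_ ?_ ?_
  · intro s t hst ht
    rcases lt_max_iff.1 ht with h | h
    · rcases le_total t u with htu | htu
      · rw [max_eq_left ((min_le_right _ _).trans (hst.trans htu)),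
          max_eq_left ((min_le_right _ _).trans htu)]
      · refine h1 _ _ (max_le_max_left _ (min_le_min_left _ hst)) (le_trans ?_ h.le)
        exact EReal.coe_le_coe_iff.2 (max_le htu (min_le_right _ _))
    · have htu : t ≤ u := (EReal.coe_lt_coe_iff.1 h).le
      rw [max_eq_left ((min_le_right _ _).trans (hst.trans htu)),
          max_eq_left ((min_le_right _ _).trans htu)]
  · intro s t hst hs
    obtain ⟨hs1, hs2⟩ := max_lt_iff.1 hs
    obtain ⟨hs3, hs4⟩ := max_lt_iff.1 hs1
    rcases le_total v s with hv | hv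
    · rw [min_eq_left hv, min_eq_left (hv.trans hst)]
    · refine h2 _ _ (max_le_max_left _ (min_le_min_left _ hst)) ?_
      rw [min_eq_right hv, max_eq_right (EReal.coe_lt_coe_iff.1 hs4).le]
      rcases min_lt_iff.1 hs2 with h | h
      · exact h.le
      · exact absurd (EReal.coe_lt_coe_iff.1 h) (not_lt.2 hv)
  · intro s t hs hst ht
    obtain ⟨hs1, hs2⟩ := max_lt_iff.1 hs
    have ht1 : (t : EReal) < min b v := by
      rcases lt_max_iff.1 ht with h | h
      · exact absurd (hs.trans_le (EReal.coe_le_coe_iff.2 hst)) (not_lt.2 h.le)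
      · exact h
    obtain ⟨ht2, ht3⟩ := lt_min_iff.1 ht1
    have hus := (EReal.coe_lt_coe_iff.1 hs2).le
    have htv := (EReal.coe_lt_coe_iff.1 ht3).le
    rw [min_eq_right htv, min_eq_right (hst.trans htv), max_eq_right hus,
      max_eq_right (hus.trans hst)]
    exact h3 s t hs1 hst ht2⟩

theorem FS.truncate_apply (u v : ℝ) (c : FS X) (t : ℝ) :
    (c.truncate u v).1 t = c.1 (max u (min v t)) := rfl

theorem FS.flow_apply (τ : ℝ) (c : FS X) (t : ℝ) : (FS.flow τ c).1 t = c.1 (t + τ) := rfl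

/-- Arzelà–Ascoli with ultrafilters: at each time the values stay in a compact thickening of `B` and
converge, and the limit is again a generalized geodesic. -/
theorem FS.isCompact_eval_zero [ProperSpace X] {B : Set X} (hB : IsCompact B) :
    IsCompact {c : FS X | c.1 0 ∈ B} := by
  rw [isCompact_iff_ultrafilter_le_nhds']
  intro f hf
  have hlim : ∀ t : ℝ, ∃ p : X, Tendsto (fun c : FS X => c.1 t) f (𝓝 p) := by
    intro t
    obtain ⟨p, -, hp⟩ := (hB.cthickening (r := |t|)).ultrafilter_le_nhds'
      (f.map fun c : FS X => c.1 t) (by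
        rw [Ultrafilter.mem_map]
        filter_upwards [hf] with c hc
        refine Metric.mem_cthickening_of_dist_le _ _ _ _ hc ?_
        simpa using c.2.dist_le t 0)
    exact ⟨p, hp⟩
  choose l hl using hlim
  choose α β hαβ _ _ h1 h2 h3 using fun c : FS X => c.2.exists_bounds
  -- The end points converge as well because `EReal` is compact. Their limits may be `⊤` or `⊥` on
  -- the wrong side, which `isGeneralizedGeodesic_of_bounds` allows.
  obtain ⟨a, -, ha⟩ := isCompact_univ.ultrafilter_le_nhds' (f.map α) Filter.univ_mem
  obtain ⟨b, -, hb⟩ := isCompact_univ.ultrafilter_le_nhds' (f.map β) Filter.univ_mem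
  replace ha : Tendsto α f (𝓝 a) := ha
  replace hb : Tendsto β f (𝓝 b) := hb
  have hdist : ∀ s t, Tendsto (fun c : FS X => dist (c.1 s) (c.1 t)) f (𝓝 (dist (l s) (l t))) :=
    fun s t => (hl s).dist (hl t)
  have hlip : LipschitzWith 1 l := LipschitzWith.of_dist_le_mul fun s t => by
    rw [NNReal.coe_one, one_mul, Real.dist_eq]
    exact le_of_tendsto' (hdist s t) fun c => c.2.dist_le s t
  have hgg : IsGeneralizedGeodesic l := by
    refine isGeneralizedGeodesic_of_bounds hlip.continuous a b (le_of_tendsto_of_tendsto' ha hb hαβ)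
      ?_ ?_ ?_
    · intro s t hst ht
      refine tendsto_nhds_unique_of_eventuallyEq (hl s) (hl t) ?_
      filter_upwards [ha.eventually_const_lt ht] with c hc using h1 c s t hst hc.le
    · intro s t hst hs
      refine tendsto_nhds_unique_of_eventuallyEq (hl s) (hl t) ?_
      filter_upwards [hb.eventually_lt_const hs] with c hc using h2 c s t hst hc.le
    · intro s t hs hst ht
      refine tendsto_nhds_unique_of_eventuallyEq (hdist s t) tendsto_const_nhds ?_
      filter_upwards [ha.eventually_lt_const hs, hb.eventually_const_lt ht] with c hc hc'
        using h3 c s t hc hst hc'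
  let L : FS X := ⟨l, hgg⟩
  refine ⟨L, ?_, ?_⟩
  · refine hB.isClosed.mem_of_tendsto (hl 0) ?_
    exact hf
  · rw [FS.isInducing_eval.nhds_eq_comap]
    refine Filter.map_le_iff_le_comap.1 ?_
    exact tendsto_pi_nhds.2 fun q => hl q

end FlowSpaceMetric

/-! ### Geodesics in 0-hyperbolic spaces and local connectedness -/

section ZeroHyperbolic

open Filter Topology

variable {X : Type*} [MetricSpace X]

variable (X) in
/-- The four-point condition that characterizes subspaces of real trees. -/
def FourPoint : Prop :=
  ∀ p q r s : X, dist p q + dist r s ≤ max (dist p r + dist q s) (dist p s + dist q r)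

/-- In a real tree, a generalized geodesic that stays close to a geodesic segment runs through the
middle part of the segment. -/
theorem FourPoint.exists_shift (hX : FourPoint X) {c c' : FS X} {a b δ : ℝ} (hδ : 0 < δ)
    (hab : a + 10 * δ ≤ b)
    (hiso : ∀ s t, a ≤ s → s ≤ t → t ≤ b → dist (c.1 s) (c.1 t) = t - s)
    (hclose : ∀ t, a ≤ t → t ≤ b → dist (c'.1 t) (c.1 t) ≤ δ) :
    ∃ s, |s| ≤ δ ∧ ∀ t, a + 5 * δ ≤ t → t ≤ b - 5 * δ → c'.1 t = c.1 (t + s) := by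
  -- From time `a` to time `b` the map `c'` covers a distance of at least `b - a - 2δ`, so it cannot
  -- rest for a time `3δ` at either end of the interval.
  have hiso' : ∀ s t, a + 3 * δ ≤ s → s ≤ t → t ≤ b - 3 * δ → dist (c'.1 s) (c'.1 t) = t - s := by
    intro s t hs hst ht
    obtain ⟨a₁, b₁, -, -, -, h1, h2, h3⟩ := c'.2.exists_bounds
    have hlong : b - a - 2 * δ ≤ dist (c'.1 a) (c'.1 b) := by
      have h4 := dist_triangle4 (c.1 a) (c'.1 a) (c'.1 b) (c.1 b)
      have h5 := hclose a le_rfl (by linarith)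
      have h6 := hclose b (by linarith) le_rfl
      rw [hiso a b le_rfl (by linarith) le_rfl, dist_comm (c.1 a)] at h4
      linarith
    refine h3 s t ?_ hst ?_
    · by_contra! hcon
      rw [h1 a s (by linarith) hcon] at hlong
      have := c'.2.dist_le s b
      rw [abs_sub_comm, abs_of_nonneg (by linarith)] at this
      linarith
    · by_contra! hcon
      rw [← h2 t b (by linarith) hcon] at hlong
      have := c'.2.dist_le a t
      rw [abs_sub_comm, abs_of_nonneg (by linarith)] at this
      linarith
  obtain ⟨a₂, ha₂⟩ : ∃ a₂, a₂ = a + 3 * δ := ⟨_, rfl⟩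
  obtain ⟨b₂, hb₂⟩ : ∃ b₂, b₂ = b - 3 * δ := ⟨_, rfl⟩
  have hAB := hiso a₂ b₂ (by linarith) (by linarith) (by linarith)
  have hPQ := hiso' a₂ b₂ (by linarith) (by linarith) (by linarith)
  have hPA := hclose a₂ (by linarith) (by linarith)
  have hQB := hclose b₂ (by linarith) (by linarith)
  have hBP1 := dist_triangle (c.1 b₂) (c.1 a₂) (c'.1 a₂)
  have hBP2 := dist_triangle (c.1 b₂) (c'.1 a₂) (c.1 a₂)
  have hAQ1 := dist_triangle (c.1 a₂) (c.1 b₂) (c'.1 b₂)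
  have hAQ2 := dist_triangle (c.1 a₂) (c'.1 b₂) (c.1 b₂)
  rw [dist_comm (c.1 b₂) (c.1 a₂), dist_comm (c.1 a₂) (c'.1 a₂)] at hBP1
  rw [dist_comm (c.1 b₂) (c.1 a₂)] at hBP2
  rw [dist_comm (c.1 b₂) (c'.1 b₂)] at hAQ1
  -- The shift is read off from the distance of `c'(a₂)` to `c(b₂)`, which is `b₂ - (a₂ + s)` if
  -- `c'(a₂) = c(a₂ + s)`.
  refine ⟨b₂ - a₂ - dist (c.1 b₂) (c'.1 a₂), abs_le.2 ⟨by linarith, by linarith⟩, ?_⟩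
  intro t ht1 ht2
  have hPm := hiso' a₂ t (by linarith) (by linarith) (by linarith)
  have hmQ := hiso' t b₂ (by linarith) (by linarith) (by linarith)
  have hBm := dist_triangle (c.1 b₂) (c'.1 b₂) (c'.1 t)
  have hAm := dist_triangle (c.1 a₂) (c'.1 a₂) (c'.1 t)
  rw [dist_comm (c.1 b₂) (c'.1 b₂), dist_comm (c'.1 b₂) (c'.1 t)] at hBm
  rw [dist_comm (c.1 a₂) (c'.1 a₂)] at hAm
  have e1 : dist (c.1 a₂) (c'.1 b₂) + dist (c.1 b₂) (c'.1 a₂) = 2 * (b₂ - a₂) := by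
    have f1 := hX (c.1 a₂) (c.1 b₂) (c'.1 a₂) (c'.1 b₂)
    have f2 := hX (c.1 a₂) (c'.1 b₂) (c.1 b₂) (c'.1 a₂)
    rw [dist_comm (c.1 a₂) (c'.1 a₂), dist_comm (c.1 b₂) (c'.1 b₂)] at f1
    rw [dist_comm (c'.1 b₂) (c'.1 a₂), dist_comm (c.1 a₂) (c'.1 a₂)] at f2
    refine le_antisymm ?_ ?_
    · rcases le_max_iff.1 f2 with h | h <;> linarith
    · rcases le_max_iff.1 f1 with h | h <;> linarith
  have e2 : dist (c.1 a₂) (c'.1 t) = t + (b₂ - a₂ - dist (c.1 b₂) (c'.1 a₂)) - a₂ := by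
    have f1 := hX (c.1 a₂) (c.1 b₂) (c'.1 a₂) (c'.1 t)
    have f2 := hX (c.1 a₂) (c'.1 t) (c.1 b₂) (c'.1 a₂)
    rw [dist_comm (c.1 a₂) (c'.1 a₂)] at f1
    rw [dist_comm (c'.1 t) (c'.1 a₂), dist_comm (c.1 a₂) (c'.1 a₂), dist_comm (c'.1 t)] at f2
    refine le_antisymm ?_ ?_
    · rcases le_max_iff.1 f2 with h | h <;> linarith
    · rcases le_max_iff.1 f1 with h | h <;> linarith
  have e3 : dist (c.1 b₂) (c'.1 t) = b₂ - (t + (b₂ - a₂ - dist (c.1 b₂) (c'.1 a₂))) := by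
    have f1 := hX (c.1 a₂) (c.1 b₂) (c'.1 t) (c'.1 b₂)
    have f2 := hX (c.1 a₂) (c'.1 b₂) (c.1 b₂) (c'.1 t)
    rw [dist_comm (c.1 b₂) (c'.1 b₂)] at f1
    rw [dist_comm (c'.1 b₂) (c'.1 t)] at f2
    refine le_antisymm ?_ ?_
    · rcases le_max_iff.1 f2 with h | h <;> linarith
    · rcases le_max_iff.1 f1 with h | h <;> linarith
  obtain ⟨u, hu⟩ : ∃ u, u = t + (b₂ - a₂ - dist (c.1 b₂) (c'.1 a₂)) := ⟨_, rfl⟩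
  rw [← hu] at e2 e3 ⊢
  have e4 := hiso a₂ u (by linarith) (by linarith) (by linarith)
  have e5 := hiso u b₂ (by linarith) (by linarith) (by linarith)
  -- Both `c'(t)` and `c(u)` lie between `c(a₂)` and `c(b₂)` at the same distances from them; the
  -- four-point condition forces such points to coincide.
  have f := hX (c'.1 t) (c.1 u) (c.1 a₂) (c.1 b₂)
  rw [dist_comm (c'.1 t) (c.1 a₂), dist_comm (c'.1 t) (c.1 b₂), dist_comm (c.1 u) (c.1 a₂)] at f
  refine dist_le_zero.1 ?_
  rcases le_max_iff.1 f with h | h <;> linarith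

/-- Clipping the moving interval of `c` to `[-R, R]` and shortening it by at most `η` at each end
leaves a core `[a, b]` with room `σ` around it. Within the window, `c` moves by at most `η` on each
side of the core, so truncating to the core changes `c` little. -/
theorem FS.exists_core {c : FS X} (hc : ∃ s t, c.1 s ≠ c.1 t) : ∃ m : ℝ, ∀ R > |m|, ∀ η > 0,
    ∃ a b σ : ℝ, 0 < σ ∧ a ≤ b ∧ -R ≤ a - σ ∧ b + σ ≤ R ∧
      (∀ s t, a - σ ≤ s → s ≤ t → t ≤ b + σ → dist (c.1 s) (c.1 t) = t - s) ∧
      (∀ t u, -R ≤ t → t ≤ u → u ≤ a → dist (c.1 u) (c.1 t) ≤ η) ∧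
      (∀ t u, t ≤ R → u ≤ t → b ≤ u → dist (c.1 u) (c.1 t) ≤ η) := by
  obtain ⟨a₁, b₁, hab, ha, hb, h1, h2, h3⟩ := c.2.exists_bounds
  have hlt : a₁ < b₁ := by
    refine hab.lt_of_ne fun h => ?_
    subst h
    obtain ⟨r, rfl⟩ : ∃ r : ℝ, (r : EReal) = a₁ := ⟨a₁.toReal, EReal.coe_toReal ha hb⟩
    have h : ∀ s, c.1 s = c.1 r := fun s => by
      rcases le_total s r with h | h
      exacts [h1 s r h le_rfl, (h2 r s h le_rfl).symm]
    obtain ⟨s, t, hst⟩ := hc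
    exact hst (by rw [h s, h t])
  obtain ⟨m, hm1, hm2⟩ := EReal.lt_iff_exists_real_btwn.1 hlt
  refine ⟨m, fun R hR η hη => ?_⟩
  obtain ⟨hR1, hR2⟩ := abs_lt.1 hR
  obtain ⟨α, hα⟩ : ∃ α : ℝ, (α : EReal) = max ((-R : ℝ) : EReal) a₁ :=
    ⟨_, EReal.coe_toReal (max_lt (EReal.coe_lt_top _) (lt_top_iff_ne_top.2 ha)).ne
      (lt_max_of_lt_left (EReal.bot_lt_coe _)).ne'⟩
  obtain ⟨β, hβ⟩ : ∃ β : ℝ, (β : EReal) = min (R : EReal) b₁ :=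
    ⟨_, EReal.coe_toReal (min_lt_of_left_lt (EReal.coe_lt_top _)).ne
      (lt_min (EReal.bot_lt_coe _) (bot_lt_iff_ne_bot.2 hb)).ne'⟩
  have hαm : α < m := by
    rw [← EReal.coe_lt_coe_iff, hα]
    exact max_lt (EReal.coe_lt_coe_iff.2 hR1) hm1
  have hmβ : m < β := by
    rw [← EReal.coe_lt_coe_iff, hβ]
    exact lt_min (EReal.coe_lt_coe_iff.2 hR2) hm2
  have hRα : -R ≤ α := by rw [← EReal.coe_le_coe_iff, hα]; exact le_max_left _ _
  have hβR : β ≤ R := by rw [← EReal.coe_le_coe_iff, hβ]; exact min_le_left _ _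
  have haα : a₁ ≤ α := hα ▸ le_max_right _ _
  have hβb : (β : EReal) ≤ b₁ := hβ ▸ min_le_right _ _
  have hσa : α < min m (α + η) := lt_min hαm (by linarith)
  have hσb : max m (β - η) < β := max_lt hmβ (by linarith)
  obtain ⟨σ, hσ, hσ2⟩ := exists_between (lt_min (sub_pos.2 hσa) (sub_pos.2 hσb))
  obtain ⟨hσ3, hσ4⟩ := lt_min_iff.1 hσ2
  have haa := min_le_right m (α + η)
  have hbb := le_max_right m (β - η)
  -- The interior time `m` keeps the two ends of the core in order even when the moving interval is
  -- shorter than `2η`.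
  refine ⟨min m (α + η), max m (β - η), σ, hσ, (min_le_left _ _).trans (le_max_left _ _),
    by linarith, by linarith, ?_, ?_, ?_⟩
  · intro s t hs hst ht
    refine h3 s t (haα.trans_lt (EReal.coe_lt_coe_iff.2 (by linarith))) hst
      (lt_of_lt_of_le (EReal.coe_lt_coe_iff.2 (by linarith)) hβb)
  · intro t u ht htu hu
    have key : ∀ v, -R ≤ v → c.1 v = c.1 (max v α) := by
      intro v hv
      rcases le_total v α with h | h
      · rw [max_eq_right h]
        rcases le_max_iff.1 hα.le with h' | h'
        · rw [le_antisymm h ((EReal.coe_le_coe_iff.1 h').trans hv)]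
        · exact h1 _ _ h h'
      · rw [max_eq_left h]
    rw [key t ht, key u (ht.trans htu)]
    refine (c.2.dist_le _ _).trans ?_
    rw [abs_of_nonneg (sub_nonneg.2 (max_le_max_right _ htu))]
    have h5 : max u α ≤ α + η := max_le (hu.trans haa) (by linarith)
    have h6 := le_max_right t α
    linarith
  · intro t u ht hut hu
    have key : ∀ v, v ≤ R → c.1 v = c.1 (min v β) := by
      intro v hv
      rcases le_total β v with h | h
      · rw [min_eq_right h]
        rcases min_le_iff.1 hβ.ge with h' | h'
        · rw [le_antisymm h (hv.trans (EReal.coe_le_coe_iff.1 h'))]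
        · exact (h2 _ _ h h').symm
      · rw [min_eq_left h]
    rw [key t ht, key u (hut.trans ht), dist_comm]
    refine (c.2.dist_le _ _).trans ?_
    rw [abs_of_nonneg (sub_nonneg.2 (min_le_min_right _ hut))]
    have h5 : β - η ≤ min u β := le_min (hbb.trans hu) (by linarith)
    have h6 := min_le_right t β
    linarith

theorem FS.continuous_truncate (c : FS X) :
    Continuous fun p : ℝ × ℝ => c.truncate p.1 p.2 := by
  refine (LipschitzWith.of_dist_le_mul (K := weightMass.toNNReal) fun p q => ?_).continuous
  rw [Real.coe_toNNReal _ weightMass_nonneg, mul_comm]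
  refine FS.dist_le_of_forall fun t => ?_
  refine (c.2.dist_le _ _).trans ?_
  have h1 : |max p.1 (min p.2 t) - max q.1 (min q.2 t)| ≤ dist p q := by
    refine (abs_max_sub_max_le_max _ _ _ _).trans (max_le_max le_rfl ?_)
    refine (abs_min_sub_min_le_max _ _ _ _).trans ?_
    rw [sub_self, abs_zero, max_eq_left (abs_nonneg _)]
    rfl
  nlinarith [mul_nonneg (dist_nonneg (x := p) (y := q)) (sq_nonneg t)]

theorem FS.continuous_truncate_flow (u v : ℝ) (c : FS X) :
    Continuous fun τ : ℝ => (FS.flow τ c).truncate u v := by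
  refine (LipschitzWith.of_dist_le_mul (K := weightMass.toNNReal) fun p q => ?_).continuous
  rw [Real.coe_toNNReal _ weightMass_nonneg, mul_comm]
  refine FS.dist_le_of_forall fun t => ?_
  refine (c.2.dist_le _ _).trans ?_
  rw [add_sub_add_left_eq_sub, ← Real.dist_eq]
  nlinarith [mul_nonneg (dist_nonneg (x := p) (y := q)) (sq_nonneg t)]

/-- The generalized geodesics obtained by stopping `c` outside a time interval that contains
`[a, b]`, together with `c`. -/
def FS.truncations (a b : ℝ) (c : FS X) : Set (FS X) :=
  insert c ((fun p : ℝ × ℝ => c.truncate p.1 p.2) '' Set.Iic a ×ˢ Set.Ici b)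

/-- The truncations form a continuous image of a quadrant, and `c` is their limit as the window
grows. -/
theorem FS.isPreconnected_truncations (a b : ℝ) (c : FS X) :
    IsPreconnected (c.truncations a b) := by
  have h : IsPreconnected ((fun p : ℝ × ℝ => c.truncate p.1 p.2) '' Set.Iic a ×ˢ Set.Ici b) :=
    (isPreconnected_Iic.prod isPreconnected_Ici).image _ c.continuous_truncate.continuousOn
  refine h.subset_closure (Set.subset_insert _ _) (Set.insert_subset ?_ subset_closure)
  refine Metric.mem_closure_iff.2 fun ε hε => ?_
  obtain ⟨R, η, -, -, hη, hR⟩ := FS.exists_dist_lt X hε 0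
  refine ⟨_, ⟨(min a (-R), max b R), ⟨Set.mem_Iic.2 (min_le_left _ _),
    Set.mem_Ici.2 (le_max_left _ _)⟩, rfl⟩, hR _ _ ?_⟩
  intro t ht
  obtain ⟨h1, h2⟩ := abs_le.1 ht
  rw [FS.truncate_apply, min_eq_right (h2.trans (le_max_right _ _)),
    max_eq_right ((min_le_right _ _).trans h1), dist_self]
  exact hη.le

/-- A nearby `c'` is joined to `c` in three moves: truncate `c'` to the core, slide this truncation,
which is that of a shift of `c`, to the truncation of `c`, and undo the truncation. Non-constancy is
what provides a core. -/
theorem FourPoint.exists_isPreconnected_nhds (hX : FourPoint X) {c : FS X}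
    (hc : ∃ s t, c.1 s ≠ c.1 t) {ε : ℝ} (hε : 0 < ε) :
    ∃ V ∈ 𝓝 c, IsPreconnected V ∧ V ⊆ Metric.ball c ε := by
  obtain ⟨m, hm⟩ := FS.exists_core hc
  obtain ⟨R, η, -, hmR, hη, hclose⟩ := FS.exists_dist_lt X hε (|m| + 1)
  obtain ⟨a, b, σ, hσ, hab, haR, hbR, hiso, hleft, hright⟩ :=
    hm R (by linarith) (η / 2) (by positivity)
  -- The trimming by `5δ` in `FourPoint.exists_shift` must fit into the margin `σ`, and `δ` added to
  -- the truncation error `η / 2` must stay below `η`.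
  obtain ⟨δ, hδ, hδσ, hδη⟩ : ∃ δ > 0, 5 * δ ≤ σ ∧ 4 * δ ≤ η :=
    ⟨min (σ / 5) (η / 4), by positivity, by linarith [min_le_left (σ / 5) (η / 4)],
      by linarith [min_le_right (σ / 5) (η / 4)]⟩
  obtain ⟨ρ, hρ, heval⟩ := FS.exists_eval_lt X R hδ
  have hclamp : ∀ u v t, u ≤ a → b ≤ v → |t| ≤ R →
      |max u (min v t)| ≤ R ∧ dist (c.1 (max u (min v t))) (c.1 t) ≤ η / 2 := by
    intro u v t hu hv ht
    obtain ⟨ht1, ht2⟩ := abs_le.1 ht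
    have huv : u ≤ v := hu.trans (hab.trans hv)
    rcases le_total t u with h | h
    · rw [max_eq_left ((min_le_right _ _).trans h)]
      exact ⟨abs_le.2 ⟨by linarith, by linarith⟩, hleft t u ht1 h hu⟩
    rcases le_total v t with h' | h'
    · rw [min_eq_left h', max_eq_right huv]
      exact ⟨abs_le.2 ⟨by linarith, by linarith⟩, hright t v ht2 h' hv⟩
    · rw [min_eq_right h', max_eq_right h, dist_self]
      exact ⟨ht, by positivity⟩
  have hball : ∀ d : FS X, (∀ t, |t| ≤ R → dist (d.1 t) (c.1 t) ≤ δ) →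
      d.truncations a b ⊆ Metric.ball c ε := by
    intro d hd
    refine Set.insert_subset (hclose _ _ fun t ht => (hd t ht).trans (by linarith)) ?_
    rintro _ ⟨⟨u, v⟩, ⟨hu, hv⟩, rfl⟩
    refine hclose _ _ fun t ht => ?_
    obtain ⟨h1, h2⟩ := hclamp u v t hu hv ht
    have h3 := dist_triangle (d.1 (max u (min v t))) (c.1 (max u (min v t))) (c.1 t)
    rw [FS.truncate_apply]
    linarith [hd _ h1]
  -- The union of all preconnected subsets of the ball that contain `c`; it remains to see that it
  -- contains a smaller ball.
  refine ⟨⋃₀ {P | IsPreconnected P ∧ c ∈ P ∧ P ⊆ Metric.ball c ε}, ?_,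
    isPreconnected_sUnion c _ (fun P hP => hP.2.1) fun P hP => hP.1,
    Set.sUnion_subset fun P hP => hP.2.2⟩
  refine Filter.mem_of_superset (Metric.ball_mem_nhds c hρ) fun c' hc' => ?_
  have hc'c : ∀ t, |t| ≤ R → dist (c'.1 t) (c.1 t) ≤ δ := fun t ht => (heval c' c hc' t ht).le
  obtain ⟨s, hs, hshift⟩ := hX.exists_shift (c := c) (c' := c') (a := a - σ) (b := b + σ) hδ
    (by linarith) hiso fun t h1 h2 => hc'c t (abs_le.2 ⟨by linarith, by linarith⟩)
  have hjoin : c'.truncate a b = (FS.flow s c).truncate a b := by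
    refine Subtype.ext (funext fun t => hshift _ ?_ ?_)
    · linarith [le_max_left a (min b t)]
    · linarith [max_le hab (min_le_left b t)]
  have hS : IsPreconnected ((fun τ : ℝ => (FS.flow τ c).truncate a b) '' Set.Icc (-δ) δ) :=
    isPreconnected_Icc.image _ (FS.continuous_truncate_flow a b c).continuousOn
  have hSball : (fun τ : ℝ => (FS.flow τ c).truncate a b) '' Set.Icc (-δ) δ ⊆
      Metric.ball c ε := by
    rintro _ ⟨τ, hτ, rfl⟩
    refine hclose _ _ fun t ht => ?_
    have h1 := (hclamp a b t le_rfl le_rfl ht).2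
    have h2 := dist_triangle (c.1 (max a (min b t) + τ)) (c.1 (max a (min b t))) (c.1 t)
    have h3 := c.2.dist_le (max a (min b t) + τ) (max a (min b t))
    rw [add_sub_cancel_left] at h3
    have h4 := abs_le.2 hτ
    change dist (c.1 (max a (min b t) + τ)) (c.1 t) ≤ η
    linarith
  have hmem : ∀ d : FS X, d.truncate a b ∈ d.truncations a b := fun d =>
    Set.mem_insert_of_mem _ ⟨(a, b), ⟨Set.mem_Iic.2 le_rfl, Set.mem_Ici.2 le_rfl⟩, rfl⟩
  have h0 : c.truncate a b ∈ (fun τ : ℝ => (FS.flow τ c).truncate a b) '' Set.Icc (-δ) δ := by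
    refine ⟨0, ⟨by linarith, hδ.le⟩, Subtype.ext (funext fun t => ?_)⟩
    change c.1 (max a (min b t) + 0) = c.1 (max a (min b t))
    rw [add_zero]
  refine ⟨c'.truncations a b ∪ ((fun τ : ℝ => (FS.flow τ c).truncate a b) '' Set.Icc (-δ) δ ∪
    c.truncations a b), ⟨?_, ?_, ?_⟩, Or.inl (Set.mem_insert _ _)⟩
  · refine (c'.isPreconnected_truncations a b).union (c'.truncate a b) (hmem c')
      (Or.inl ⟨s, abs_le.1 hs, hjoin.symm⟩) ?_
    exact hS.union (c.truncate a b) h0 (hmem c) (c.isPreconnected_truncations a b)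
  · exact Or.inr (Or.inr (Set.mem_insert _ _))
  · exact Set.union_subset (hball c' hc'c) (Set.union_subset hSball
      (hball c fun t _ => by rw [dist_self]; exact hδ.le))

end ZeroHyperbolic

/-! ### Arithmetic of balls and of `𝓞_K[1/x]` -/

section InvRing

variable {K : Type*} [Field K] {x : 𝓞 K}

theorem zpow_mem_invRing [NeZero x] (k : ℤ) : (x : K) ^ k ∈ InvRing x := by
  rw [← xUnit_zpow]; exact Subtype.property _

theorem coe_mem_invRing (z : 𝓞 K) : (z : K) ∈ InvRing x := (InvRing x).algebraMap_mem z

end InvRing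

section Arithmetic

variable {K : Type*} [Field K] [NumberField K] {x : 𝓞 K}

theorem mem_levelBall_iff_sub {a y : K} {l : ℤ} :
    y ∈ levelBall x a l ↔ y - a ∈ levelBall x 0 l := by
  simp [levelBall]

theorem add_mem_levelBall_zero {y z : K} {l : ℤ} (hy : y ∈ levelBall x 0 l)
    (hz : z ∈ levelBall x 0 l) : y + z ∈ levelBall x 0 l := by
  intro 𝔭 h𝔭
  have h1 := hy 𝔭 h𝔭
  have h2 := hz 𝔭 h𝔭
  rw [sub_zero] at *
  exact (𝔭.valuation K).map_add_le h1 h2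

theorem coe_mem_levelBall_zero (z : 𝓞 K) : (z : K) ∈ levelBall x 0 0 := by
  intro 𝔭 _
  rw [sub_zero, zpow_zero]
  exact 𝔭.valuation_le_one z

theorem mul_mem_levelBall_zero {y z : K} {l : ℤ} (hy : y ∈ levelBall x 0 l)
    (hz : z ∈ levelBall x 0 0) : z * y ∈ levelBall x 0 l := by
  intro 𝔭 h𝔭
  have h1 := hy 𝔭 h𝔭
  have h2 := hz 𝔭 h𝔭
  rw [sub_zero] at *
  rw [zpow_zero] at h2
  rw [map_mul]
  simpa using mul_le_mul' h2 h1

theorem zpow_mul_mem_levelBall_iff [NeZero x] (k : ℤ) {a y : K} {l : ℤ} :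
    (x : K) ^ k * y ∈ levelBall x ((x : K) ^ k * a) (l + k) ↔ y ∈ levelBall x a l := by
  refine forall_congr' fun 𝔭 => forall_congr' fun h𝔭 => ?_
  have h0 : 0 < 𝔭.valuation K (x : K) := by
    rw [zero_lt_iff]; exact (Valuation.ne_zero_iff _).2 (coe_ne_zero x)
  rw [← mul_sub, map_mul, map_zpow₀, zpow_add₀ h0.ne', mul_comm]
  exact mul_le_mul_iff_left₀ (zpow_pos h0 _)

theorem zpow_mul_mem_levelBall_zero_iff [NeZero x] (k : ℤ) {y : K} {l : ℤ} :
    (x : K) ^ k * y ∈ levelBall x 0 (l + k) ↔ y ∈ levelBall x 0 l := by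
  simpa using zpow_mul_mem_levelBall_iff (x := x) (a := (0 : K)) (y := y) (l := l) k

/-- The ring of integers is dense in the semilocal ring of elements that are integral at the
primes dividing `x`. -/
theorem exists_integer_mem_levelBall [NeZero x] {y : K} (hy : y ∈ levelBall x 0 0) (m : ℕ) :
    ∃ z : 𝓞 K, y ∈ levelBall x (z : K) m := by
  -- The ideal of denominators of `y`. It is coprime to `x` because `y` is integral at the primes
  -- dividing `x`.
  let I : Ideal (𝓞 K) :=
    { carrier := {v | ∃ u : 𝓞 K, (v : K) * y = u}
      add_mem' := by
        rintro v w ⟨u, hu⟩ ⟨u', hu'⟩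
        exact ⟨u + u', by push_cast; rw [add_mul, hu, hu']⟩
      zero_mem' := ⟨0, by simp⟩
      smul_mem' := by
        rintro r v ⟨u, hu⟩
        exact ⟨r * u, by rw [smul_eq_mul]; push_cast; rw [mul_assoc, hu]⟩ }
  have hI : I ⊔ Ideal.span {x} = ⊤ := by
    by_contra hne
    obtain ⟨M, hM, hIM⟩ := Ideal.exists_le_maximal _ hne
    have hxM : x ∈ M := hIM (Ideal.mem_sup_right (Ideal.mem_span_singleton_self x))
    let 𝔭 : HeightOneSpectrum (𝓞 K) := ⟨M, hM.isPrime, fun h => NeZero.ne x (by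
      rw [h] at hxM; exact hxM)⟩
    have h1 := hy 𝔭 (Ideal.dvd_span_singleton.2 hxM)
    rw [sub_zero, zpow_zero] at h1
    obtain ⟨n, d, hd⟩ := 𝔭.exists_primeCompl_mul_eq_of_integer y h1
    exact d.2 (hIM (Ideal.mem_sup_left ⟨n, by rw [mul_comm]; exact hd⟩))
  have hco : IsCoprime I (Ideal.span {x ^ m}) := by
    rw [← Ideal.span_singleton_pow]
    exact (Ideal.isCoprime_iff_sup_eq.2 hI).pow_right
  obtain ⟨v, ⟨u, hu⟩, w, hw, hvw⟩ := Ideal.isCoprime_iff_exists.1 hco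
  obtain ⟨r, rfl⟩ := Ideal.mem_span_singleton.1 hw
  refine ⟨u, mem_levelBall_iff_sub.2 ?_⟩
  -- From `v + xᵐ r = 1` and `v y = u`, where `v` is a denominator of `y`.
  have h1 : y - u = (x : K) ^ (m : ℤ) * ((r : K) * y) := by
    have h2 : (v : K) + (x : K) ^ m * r = 1 := by exact_mod_cast congrArg (algebraMap (𝓞 K) K) hvw
    rw [← hu, zpow_natCast]
    linear_combination (-y) * h2
  rw [h1]
  simpa using (zpow_mul_mem_levelBall_zero_iff (m : ℤ)).2
    (mul_mem_levelBall_zero hy (coe_mem_levelBall_zero r))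

theorem exists_finite_residues {y : 𝓞 K} (hy : y ≠ 0) :
    ∃ S : Set (𝓞 K), S.Finite ∧ ∀ z, ∃ s ∈ S, ∃ r, z = s + y * r := by
  have : Finite (𝓞 K ⧸ Ideal.span {y}) := Ring.HasFiniteQuotients.finiteQuotient (by simpa using hy)
  refine ⟨Set.range (Quotient.out : 𝓞 K ⧸ Ideal.span {y} → 𝓞 K), Set.finite_range _, fun z => ?_⟩
  refine ⟨_, ⟨Ideal.Quotient.mk _ z, rfl⟩, ?_⟩
  have h : z - Quotient.out (Ideal.Quotient.mk (Ideal.span {y}) z) ∈ Ideal.span {y} := by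
    rw [← Ideal.Quotient.eq, ← Submodule.Quotient.mk_out (Ideal.Quotient.mk _ z)]
    simp
  obtain ⟨r, hr⟩ := Ideal.mem_span_singleton.1 h
  exact ⟨r, by rw [← hr]; ring⟩

/-- After rescaling to the unit ball, an element is approximated by an integer and only its class
modulo `x^(m - l)` matters. The truncated exponent also covers `m < l`, where the modulus is one. -/
theorem exists_finite_centers [NeZero x] (a : K) (l m : ℤ) :
    ∃ S : Set K, S.Finite ∧ ∀ y ∈ levelBall x a l, ∃ s ∈ S, y ∈ levelBall x s m := by
  obtain ⟨S, hS, h⟩ := exists_finite_residues (y := x ^ (m - l).toNat) (pow_ne_zero _ (NeZero.ne x))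
  refine ⟨(fun s : 𝓞 K => a + (x : K) ^ l * s) '' S, hS.image _, fun y hy => ?_⟩
  have hx := coe_ne_zero x
  have h1 : (x : K) ^ (-l) * (y - a) ∈ levelBall x 0 0 := by
    have := (zpow_mul_mem_levelBall_zero_iff (-l)).2 (mem_levelBall_iff_sub.1 hy)
    simpa using this
  obtain ⟨z, hz⟩ := exists_integer_mem_levelBall h1 (m - l).toNat
  obtain ⟨s, hs, r, rfl⟩ := h z
  refine ⟨_, ⟨s, hs, rfl⟩, mem_levelBall_iff_sub.2 ?_⟩
  have h2 : (x : K) ^ ((m - l).toNat : ℤ) * (r : K) ∈ levelBall x 0 ((m - l).toNat : ℤ) := by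
    simpa using (zpow_mul_mem_levelBall_zero_iff ((m - l).toNat : ℤ)).2 (coe_mem_levelBall_zero r)
  have h3 := add_mem_levelBall_zero (mem_levelBall_iff_sub.1 hz) h2
  have h4 := (zpow_mul_mem_levelBall_zero_iff l).2 h3
  refine levelBall_mono 0 (show m ≤ ((m - l).toNat : ℤ) + l by omega) ?_
  convert h4 using 1
  push_cast
  rw [zpow_neg]
  field_simp
  rw [zpow_natCast]
  ring

/-- Density of `𝓞_K[1/x]`: a power of `x` makes `y` integral at the primes dividing `x`, where `𝓞_K`
is dense. -/
theorem exists_invRing_mem_levelBall [NeZero x] (y : K) (l : ℤ) :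
    ∃ b ∈ InvRing x, y ∈ levelBall x b l := by
  obtain ⟨l₀, hl₀⟩ := exists_mem_levelBall (x := x) 0 y
  have h1 : (x : K) ^ (-l₀) * y ∈ levelBall x 0 0 := by
    simpa using (zpow_mul_mem_levelBall_zero_iff (-l₀)).2 (hl₀ l₀ le_rfl)
  obtain ⟨z, hz⟩ := exists_integer_mem_levelBall h1 (l - l₀).toNat
  refine ⟨(x : K) ^ l₀ * z, mul_mem (zpow_mem_invRing l₀) (coe_mem_invRing z), ?_⟩
  have h2 := (zpow_mul_mem_levelBall_iff l₀).2 hz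
  rw [← mul_assoc, ← zpow_add₀ (coe_ne_zero x), add_neg_cancel, zpow_zero, one_mul] at h2
  exact levelBall_mono _ (by omega) h2

/-- At primes not dividing `x` the generator `1/x` is a unit, so every element of `𝓞_K[1/x]` is
integral there; at the other primes integrality is the hypothesis. -/
theorem exists_integer_of_mem_invRing [NeZero x] {b : K} (hb : b ∈ InvRing x)
    (h : b ∈ levelBall x 0 0) : ∃ z : 𝓞 K, (z : K) = b := by
  refine HeightOneSpectrum.mem_integers_of_valuation_le_one K b fun 𝔭 => ?_
  by_cases h𝔭 : 𝔭.asIdeal ∣ Ideal.span {x}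
  · simpa using h 𝔭 h𝔭
  have hx1 : 𝔭.valuation K (x : K) = 1 :=
    le_antisymm (𝔭.valuation_le_one x) (not_lt.1 fun h => h𝔭 ((𝔭.valuation_lt_one_iff_dvd x).1 h))
  clear h
  induction hb using Algebra.adjoin_induction with
  | mem y hy =>
    rw [Set.mem_singleton_iff.1 hy, map_inv₀, hx1, inv_one]
  | algebraMap r => exact 𝔭.valuation_le_one r
  | add y z _ _ hy hz => exact (𝔭.valuation K).map_add_le hy hz
  | mul y z _ _ hy hz => rw [map_mul]; exact mul_le_one' hy hz

theorem exists_pow_mul_mem_integers [NeZero x] {b : K} (hb : b ∈ InvRing x) :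
    ∃ (n : ℕ) (z : 𝓞 K), (x : K) ^ n * b = z := by
  obtain ⟨l₀, hl₀⟩ := exists_mem_levelBall (x := x) 0 b
  have h1 := (zpow_mul_mem_levelBall_zero_iff (l₀.natAbs : ℤ)).2
    (hl₀ (-(l₀.natAbs : ℤ)) (by omega))
  rw [neg_add_cancel] at h1
  obtain ⟨z, hz⟩ := exists_integer_of_mem_invRing
    (mul_mem (zpow_mem_invRing (l₀.natAbs : ℤ)) hb) h1
  exact ⟨l₀.natAbs, z, by rw [hz, zpow_natCast]⟩

end Arithmetic

/-! ### Elements of `Γ` as pairs -/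

section GammaElements

variable {K : Type*} [Field K] {x : 𝓞 K} [NeZero x]

/-- The element `(b, k)` of `Γ`. -/
def Gamma.mk (b : InvRing x) (k : ℤ) : Gamma x := ⟨.ofAdd b, .ofAdd k⟩

@[simp] theorem Gamma.mk_b (b : InvRing x) (k : ℤ) : (Gamma.mk b k).b = b := rfl

@[simp] theorem Gamma.mk_k (b : InvRing x) (k : ℤ) : (Gamma.mk b k).k = k := rfl

theorem Gamma.b_mem (g : Gamma x) : g.b ∈ InvRing x := Subtype.property _

theorem Gamma.ext_bk {g h : Gamma x} (hb : g.b = h.b) (hk : g.k = h.k) : g = h :=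
  SemidirectProduct.ext (Multiplicative.toAdd.injective (Subtype.ext hb))
    (Multiplicative.toAdd.injective hk)

end GammaElements

/-! ### The tree is 0-hyperbolic and proper -/

section TreeGeometry

set_option linter.unusedSectionVars false

variable {K : Type*} [Field K] [NumberField K] {x : 𝓞 K} [NeZero x]

theorem Tree.le_meet {p q r : Tree x} (hp : p.OnRay r) (hq : q.OnRay r) : r.height ≤ p.meet q :=
  le_csSup (Tree.meetSet_bddAbove p q) ⟨r, hp, hq, rfl⟩

theorem Tree.meet_le_right (p q : Tree x) : p.meet q ≤ q.height := by
  rw [Tree.meet_comm]; exact Tree.meet_le_left q p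

theorem Tree.exists_onRay_of_lt_meet {p q : Tree x} {h : ℝ} (hh : h < p.meet q) :
    ∃ r : Tree x, p.OnRay r ∧ q.OnRay r ∧ h < r.height := by
  obtain ⟨_, ⟨r, hp, hq, rfl⟩, hr⟩ := exists_lt_of_lt_csSup (Tree.meetSet_nonempty p q) hh
  exact ⟨r, hp, hq, hr⟩

/-- Two points on the ray from `r` are ordered, so the lower of the two meeting points lies on all
three rays. This ultrametric inequality is the only geometric input for the four-point condition. -/
theorem Tree.min_meet_le (p q r : Tree x) : min (p.meet r) (r.meet q) ≤ p.meet q := by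
  refine le_of_forall_lt fun h hh => ?_
  obtain ⟨h1, h2⟩ := lt_min_iff.1 hh
  obtain ⟨s, hps, hrs, hs⟩ := Tree.exists_onRay_of_lt_meet h1
  obtain ⟨t, hrt, hqt, ht⟩ := Tree.exists_onRay_of_lt_meet h2
  rcases le_total s.height t.height with hst | hst
  · exact hs.trans_le (Tree.le_meet hps (hqt.trans (hrt.of_le hrs hst)))
  · exact ht.trans_le (Tree.le_meet (hps.trans (hrs.of_le hrt hst)) hqt)

variable (x) in
theorem Tree.fourPoint : FourPoint (Tree x) := by
  intro p q r s
  have h1 := Tree.min_meet_le p q r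
  have h2 := Tree.min_meet_le p q s
  have h3 := Tree.min_meet_le r s p
  have h4 := Tree.min_meet_le r s q
  rw [Tree.meet_comm r q] at h1
  rw [Tree.meet_comm s q] at h2
  rw [Tree.meet_comm r p] at h3
  rw [Tree.meet_comm r q] at h4
  simp only [Tree.dist_def]
  by_contra! hcon
  obtain ⟨h5, h6⟩ := max_lt_iff.1 hcon
  rcases min_le_iff.1 h1 with h1 | h1 <;> rcases min_le_iff.1 h2 with h2 | h2 <;>
    rcases min_le_iff.1 h3 with h3 | h3 <;> rcases min_le_iff.1 h4 with h4 | h4 <;> linarith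

theorem Tree.abs_height_sub_le_dist (p q : Tree x) : |p.height - q.height| ≤ dist p q := by
  rw [Tree.dist_def, abs_le]
  constructor <;> linarith [Tree.meet_le_left p q, Tree.meet_le_right p q]

theorem Tree.continuous_height : Continuous fun p : Tree x => p.height :=
  (LipschitzWith.of_dist_le_mul (K := 1) fun p q => by
    simpa [Real.dist_eq] using Tree.abs_height_sub_le_dist p q).continuous

theorem Tree.height_sub_dist_le_meet (p q : Tree x) : p.height - dist p q ≤ p.meet q := by
  rw [Tree.dist_def]; linarith [Tree.meet_le_right p q]

theorem Tree.mk'_height (h : ℝ) (a : K) : (Tree.mk' x h a).height = h := rfl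

theorem Tree.mem_mk' (h : ℝ) (a : K) : a ∈ (Tree.mk' x h a).ball := mem_levelBall_self a _

theorem Tree.eq_mk' {p : Tree x} {a : K} (ha : a ∈ p.ball) : p = Tree.mk' x p.height a :=
  Tree.ext_of_mem rfl ha (Tree.mem_mk' _ _)

theorem Tree.mk'_onRay {h h' : ℝ} (hh : h' ≤ h) (a : K) :
    (Tree.mk' x h a).OnRay (Tree.mk' x h' a) :=
  ⟨hh, levelBall_mono a (Int.ceil_mono hh)⟩

theorem Tree.mk'_eq_mk' {h : ℝ} {a b : K} {l : ℤ} (hl : h ≤ l) (hab : a ∈ levelBall x b l) :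
    Tree.mk' x h a = Tree.mk' x h b :=
  Tree.ext rfl (levelBall_eq (levelBall_mono b (Int.ceil_le.2 hl) hab))

theorem Tree.dist_mk' (h h' : ℝ) (a : K) :
    dist (Tree.mk' x h a) (Tree.mk' x h' a) = |h - h'| := by
  wlog hh : h' ≤ h generalizing h h'
  · rw [dist_comm, abs_sub_comm]; exact this _ _ (le_of_not_ge hh)
  refine le_antisymm ?_
    (Tree.abs_height_sub_le_dist (Tree.mk' x h a) (Tree.mk' x h' a))
  have := Tree.le_meet (Tree.mk'_onRay (x := x) hh a) (Tree.onRay_refl _)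
  rw [Tree.dist_def, abs_of_nonneg (sub_nonneg.2 hh)]
  rw [Tree.mk'_height] at *
  rw [Tree.mk'_height]
  linarith

theorem Tree.isometry_mk' (a : K) : Isometry fun h : ℝ => Tree.mk' x h a :=
  Isometry.of_dist_eq fun h h' => Tree.dist_mk' h h' a

theorem Tree.smul_mk' (g : Gamma x) (h : ℝ) (a : K) :
    g • Tree.mk' x h a = Tree.mk' x (h + g.k) ((x : K) ^ g.k * a + g.b) :=
  Tree.ext_of_mem rfl ⟨a, Tree.mem_mk' _ _, rfl⟩ (Tree.mem_mk' _ _)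

instance : ProperSpace (Tree x) where
  isCompact_closedBall p r := by
    obtain ⟨a, ha⟩ := p.nonempty
    -- The ray from a point of the closed ball meets the ray from `p` at height at least `p.height -
    -- r`. The extra `1` gives a strict inequality, as the meeting height is a supremum. Finitely
    -- many vertical segments then cover the ball.
    obtain ⟨S, hS, hcov⟩ := exists_finite_centers (x := x) a ⌊p.height - r - 1⌋ ⌈p.height + r⌉
    have hK : IsCompact (⋃ s ∈ S, (fun h => Tree.mk' x h s) ''
        Set.Icc (p.height - r) (p.height + r)) :=
      hS.isCompact_biUnion fun s _ => isCompact_Icc.image (Tree.isometry_mk' s).continuous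
    refine hK.of_isClosed_subset Metric.isClosed_closedBall fun q hq => ?_
    rw [Metric.mem_closedBall, dist_comm] at hq
    have h1 := Tree.height_sub_dist_le_meet p q
    obtain ⟨s, hps, hqs, hs⟩ :=
      Tree.exists_onRay_of_lt_meet (show p.height - r - 1 < p.meet q by linarith)
    obtain ⟨y, hy⟩ := q.nonempty
    have hya : y ∈ levelBall x a ⌊p.height - r - 1⌋ := by
      have h2 : y ∈ s.ball := hqs.2 hy
      rw [s.ball_eq (hps.2 ha)] at h2
      refine levelBall_mono a ?_ h2
      exact (Int.floor_le_ceil _).trans (Int.ceil_mono hs.le)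
    obtain ⟨c, hc, hyc⟩ := hcov y hya
    obtain ⟨h3, h4⟩ := abs_le.1 ((Tree.abs_height_sub_le_dist p q).trans hq)
    refine Set.mem_biUnion hc ⟨q.height, ⟨by linarith, by linarith⟩, ?_⟩
    change Tree.mk' x q.height c = q
    rw [Tree.eq_mk' hy]
    exact (Tree.mk'_eq_mk' ((show q.height ≤ p.height + r by linarith).trans (Int.le_ceil _))
      hyc).symm

end TreeGeometry

/-! ### Proper and cocompact action -/

section Cocompact

set_option linter.unusedSectionVars false

variable {K : Type*} [Field K] [NumberField K] {ι : Type*} [Fintype ι] [DecidableEq ι]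
variable {x : 𝓞 K} [NeZero x] {e : Basis ι ℤ (𝓞 K)}

theorem coords_coe (z : 𝓞 K) (i : ι) : coords e (z : K) i = ((e.repr z i : ℤ) : ℝ) := by
  unfold coords
  rw [show (z : K) = algebraMap (𝓞 K) K z from rfl,
    Basis.localizationLocalization_repr_algebraMap]
  simp

theorem coords_injective : Function.Injective (coords e : K → ι → ℝ) := by
  intro b c h
  refine (e.localizationLocalization ℚ (nonZeroDivisors ℤ) K).repr.injective (Finsupp.ext fun i => ?_)
  exact Rat.cast_injective (α := ℝ) (congrFun h i)

theorem smul_RSpace_def (g : Gamma x) (w : RSpace e) : g • w = affineMap e g w := rfl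

theorem finite_setOf_coords_mem {B : Set (ι → ℝ)} (hB : Bornology.IsBounded B) :
    {z : 𝓞 K | coords e (z : K) ∈ B}.Finite := by
  obtain ⟨r, hr⟩ := isBounded_iff_forall_norm_le.1 hB
  refine Set.Finite.of_finite_image (f := e.equivFun) ?_ e.equivFun.injective.injOn
  refine (Set.finite_Icc (fun _ : ι => -⌈r⌉) (fun _ => ⌈r⌉)).subset ?_
  rintro _ ⟨z, hz, rfl⟩
  have h : ∀ i, |e.repr z i| ≤ ⌈r⌉ := fun i => by
    have h1 := (norm_le_pi_norm _ i).trans (hr _ hz)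
    rw [coords_coe, Real.norm_eq_abs] at h1
    have h2 := h1.trans (Int.le_ceil r)
    exact_mod_cast h2
  exact ⟨fun i => (abs_le.1 (h i)).1, fun i => (abs_le.1 (h i)).2⟩

/-- Multiplication by `xᵐ` clears the denominators, leaving algebraic integers with bounded
coordinates, of which there are finitely many. -/
theorem finite_setOf_gamma (k : ℤ) (m : ℕ) {B : Set (ι → ℝ)} (hB : IsCompact B) :
    {g : Gamma x | g.k = k ∧ g.b ∈ levelBall x 0 (-(m : ℤ)) ∧ coords e g.b ∈ B}.Finite := by
  have hB' : IsCompact ((fun v => v ᵥ* (xMatrix e x ^ (m : ℤ))) '' B) := hB.image (by fun_prop)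
  have hfin := (finite_setOf_coords_mem (e := e) hB'.isBounded).image (algebraMap (𝓞 K) K)
  refine Set.Finite.of_finite_image (f := fun g : Gamma x => (x : K) ^ (m : ℤ) * g.b)
    (hfin.subset ?_) ?_
  · rintro _ ⟨g, ⟨-, hg, hgB⟩, rfl⟩
    have h1 := (zpow_mul_mem_levelBall_zero_iff (m : ℤ)).2 hg
    rw [neg_add_cancel] at h1
    obtain ⟨z, hz⟩ := exists_integer_of_mem_invRing (mul_mem (zpow_mem_invRing (m : ℤ)) g.b_mem) h1
    refine ⟨z, ?_, hz⟩
    rw [Set.mem_ofPred_eq, hz, coords_zpow_mul]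
    exact ⟨_, hgB, rfl⟩
  · intro g hg h hh hgh
    exact Gamma.ext_bk (mul_left_cancel₀ (zpow_ne_zero _ (coe_ne_zero x)) hgh) (hg.1.trans hh.1.symm)

/-- If `g = (b, k)` returns the neighbourhood to itself, it displaces `c(0)` by less than two. This
bounds `k` and the denominators of `b`, while the factor `ℝⁿ` bounds the coordinates of `b`. -/
theorem actsProperly_HFS : ActsProperly (Gamma x) (HFS x e) := by
  rintro ⟨c, w⟩
  obtain ⟨a, ha⟩ := (c.1 0).nonempty
  let v : ι → ℝ := w
  let W : Set (ι → ℝ) := Metric.ball v 1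
  have hW : IsOpen W := Metric.isOpen_ball
  refine ⟨((fun c : FS (Tree x) => c.1 0) ⁻¹' Metric.ball (c.1 0) 1) ×ˢ W,
    (Metric.isOpen_ball.preimage (FS.continuous_eval 0)).prod hW,
    ⟨Metric.mem_ball_self one_pos, Metric.mem_ball_self (x := v) one_pos⟩, ?_⟩
  -- Here `y = (xᵏ a + y - a) + (a - xᵏ a)`: the first summand is bounded by hypothesis and the
  -- second depends only on `k`.
  have key : ∀ k : ℤ, ∃ m : ℕ, ∀ y : K,
      (x : K) ^ k * a + y ∈ levelBall x a ⌊(c.1 0).height - 2⌋ → y ∈ levelBall x 0 (-(m : ℤ)) := by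
    intro k
    obtain ⟨l, hl⟩ := exists_mem_levelBall (x := x) 0 (a - (x : K) ^ k * a)
    refine ⟨l.natAbs + ⌊(c.1 0).height - 2⌋.natAbs, fun y hy => ?_⟩
    have h1 := hl (-((l.natAbs + ⌊(c.1 0).height - 2⌋.natAbs : ℕ) : ℤ)) (by omega)
    have h2 := levelBall_mono 0 (show -((l.natAbs + ⌊(c.1 0).height - 2⌋.natAbs : ℕ) : ℤ) ≤
      ⌊(c.1 0).height - 2⌋ by omega) (mem_levelBall_iff_sub.1 hy)
    convert add_mem_levelBall_zero h1 h2 using 1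
    ring
  choose m hm using key
  have hB : ∀ k : ℤ, IsCompact ((fun q : (ι → ℝ) × (ι → ℝ) => q.1 - q.2 ᵥ* (xMatrix e x ^ k)) ''
      (Metric.closedBall v 1 ×ˢ Metric.closedBall v 1)) := fun k =>
    ((isCompact_closedBall _ _).prod (isCompact_closedBall _ _)).image (by fun_prop)
  refine ((Set.finite_Icc (-2 : ℤ) 2).biUnion fun k _ =>
    finite_setOf_gamma (x := x) (e := e) k (m k) (hB k)).subset ?_
  rintro g ⟨_, ⟨⟨c', w'⟩, ⟨hc', hw'⟩, rfl⟩, hgc, hgw⟩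
  replace hc' : dist (c'.1 0) (c.1 0) < 1 := hc'
  replace hgc : dist (g • c'.1 0) (c.1 0) < 1 := hgc
  have hdist : dist (c.1 0) (g • c.1 0) < 2 := by
    have h1 := dist_triangle (c.1 0) (g • c'.1 0) (g • c.1 0)
    rw [dist_smul, dist_comm (c.1 0) (g • c'.1 0)] at h1
    linarith
  have hk := (Tree.abs_height_sub_le_dist _ _).trans_lt hdist
  rw [Tree.smul_height, sub_add_cancel_left, abs_neg] at hk
  have hk' : |g.k| < 2 := by exact_mod_cast hk
  rw [abs_lt] at hk'
  refine Set.mem_biUnion (x := g.k) ⟨hk'.1.le, hk'.2.le⟩ ⟨rfl, hm _ _ ?_, ?_⟩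
  · have h1 := Tree.height_sub_dist_le_meet (c.1 0) (g • c.1 0)
    obtain ⟨s, hs1, hs2, hs⟩ := Tree.exists_onRay_of_lt_meet
      (show (c.1 0).height - 2 < (c.1 0).meet (g • c.1 0) by linarith)
    have h2 : (x : K) ^ g.k * a + g.b ∈ s.ball := hs2.2 ⟨a, ha, rfl⟩
    rw [s.ball_eq (hs1.2 ha)] at h2
    exact levelBall_mono a ((Int.floor_le_ceil _).trans (Int.ceil_mono hs.le)) h2
  · refine ⟨(affineMap e g w', w'), ⟨Metric.ball_subset_closedBall hgw,
      Metric.ball_subset_closedBall hw'⟩, ?_⟩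
    simp [affineMap]

theorem actsCocompactly_HFS : ActsCocompactly (Gamma x) (HFS x e) := by
  -- The segment of heights in `[0, 1]` over `0` involves balls of level one, which `x 𝓞_K`
  -- preserves but `𝓞_K` in general does not. So the compact set is a fundamental parallelepiped of
  -- `x 𝓞_K`.
  let D : Set (ι → ℝ) := (fun v => v ᵥ* xMatrix e x) '' Set.Icc 0 1
  have hD : IsCompact D := isCompact_Icc.image (by fun_prop)
  refine ⟨{c : FS (Tree x) | c.1 0 ∈ (fun h => Tree.mk' x h 0) '' Set.Icc 0 1} ×ˢ D,
    (FS.isCompact_eval_zero (isCompact_Icc.image (Tree.isometry_mk' 0).continuous)).prod hD, ?_⟩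
  refine Set.eq_univ_of_forall ?_
  rintro ⟨c, w⟩
  obtain ⟨a, ha⟩ := (c.1 0).nonempty
  -- Level `⌊h⌋ + 1` is at least `⌈h⌉`, so `b` determines the same point at height `h` as `a`.
  obtain ⟨b, hb, hab⟩ := exists_invRing_mem_levelBall (x := x) a (⌊(c.1 0).height⌋ + 1)
  let g : Gamma x := Gamma.mk ⟨b, hb⟩ ⌊(c.1 0).height⌋
  let w₁ : ι → ℝ := (g⁻¹ • w : RSpace e)
  let u : ι → ℝ := w₁ ᵥ* (xMatrix e x)⁻¹
  let z : 𝓞 K := e.equivFun.symm fun i => ⌊u i⌋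
  let t : Gamma x := Gamma.mk ⟨x * z, mul_mem (coe_mem_invRing x) (coe_mem_invRing z)⟩ 0
  let w₂ : ι → ℝ := (fun i => Int.fract (u i)) ᵥ* xMatrix e x
  have hz : coords e (z : K) = fun i => (⌊u i⌋ : ℝ) := by
    ext i
    rw [coords_coe, ← Basis.equivFun_apply, LinearEquiv.apply_symm_apply]
  have htw : affineMap e t w₂ = w₁ := by
    rw [affineMap]
    change w₂ ᵥ* (xMatrix e x ^ (0 : ℤ)) + coords e ((x : K) * z) = w₁
    rw [coords_mul, hz, zpow_zero, Matrix.vecMul_one, ← Matrix.add_vecMul]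
    have : ((fun i => Int.fract (u i)) + fun i => (⌊u i⌋ : ℝ)) = u :=
      funext fun i => Int.fract_add_floor (u i)
    rw [this, Matrix.vecMul_vecMul, Matrix.nonsing_inv_mul _ (isUnit_det_xMatrix e x),
      Matrix.vecMul_one]
  have htp : (g * t) • Tree.mk' x (Int.fract (c.1 0).height) 0 = c.1 0 := by
    rw [mul_smul, Tree.smul_mk' t, Tree.smul_mk' g]
    change Tree.mk' x (Int.fract (c.1 0).height + ((0 : ℤ) : ℝ) + (⌊(c.1 0).height⌋ : ℝ))
      ((x : K) ^ ⌊(c.1 0).height⌋ * ((x : K) ^ (0 : ℤ) * 0 + (x : K) * z) + b) = c.1 0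
    rw [Int.cast_zero, add_zero, Int.fract_add_floor, Tree.eq_mk' ha, Tree.mk'_height, mul_zero,
      zero_add]
    have hle : (c.1 0).height ≤ (⌊(c.1 0).height⌋ + 1 : ℤ) := by
      push_cast; exact (Int.lt_floor_add_one _).le
    rw [Tree.mk'_eq_mk' hle hab]
    refine Tree.mk'_eq_mk' hle ?_
    rw [mem_levelBall_iff_sub, add_sub_cancel_right, add_comm ⌊(c.1 0).height⌋,
      zpow_mul_mem_levelBall_zero_iff]
    have := (zpow_mul_mem_levelBall_zero_iff (x := x) 1).2 (coe_mem_levelBall_zero (x := x) z)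
    simpa using this
  refine Set.mem_iUnion.2 ⟨g * t, Set.mem_smul_set_iff_inv_smul_mem.2 ⟨?_, ?_⟩⟩
  · refine ⟨Int.fract (c.1 0).height, ⟨Int.fract_nonneg _, (Int.fract_lt_one _).le⟩, ?_⟩
    exact eq_inv_smul_iff.2 htp
  · refine ⟨fun i => Int.fract (u i), ⟨fun i => Int.fract_nonneg _,
      fun i => (Int.fract_lt_one _).le⟩, ?_⟩
    have hw₂ : (g * t) • (show RSpace e from w₂) = w := by
      rw [smul_RSpace_def]
      refine (affineMap_mul e g t w₂).trans ?_
      rw [htw]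
      exact smul_inv_smul g w
    have hw₂' := eq_inv_smul_iff.2 hw₂
    exact hw₂'

end Cocompact

/-! ### Flow lines of bounded period -/

section Periods

set_option linter.unusedSectionVars false

/-- A finite end point would make `c` constant on a half-line, and `g` would fix the value there. -/
theorem FS.dist_eq_of_equivariant {X G : Type*} [MetricSpace X] [Group G] [MulAction G X]
    {c : FS X} {τ : ℝ} (hτ : 0 < τ) {g : G} (hg : ∀ t, c.1 (t + τ) = g • c.1 t)
    (hfix : ∀ p : X, g • p ≠ p) {s t : ℝ} (hst : s ≤ t) : dist (c.1 s) (c.1 t) = t - s := by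
  obtain ⟨a, b, -, ha, hb, h1, h2, h3⟩ := c.2.exists_bounds
  have ha' : a = ⊥ := by
    by_contra hne
    obtain ⟨r, rfl⟩ : ∃ r : ℝ, (r : EReal) = a := ⟨a.toReal, EReal.coe_toReal ha hne⟩
    have h4 := h1 (r - τ) r (by linarith) le_rfl
    have h5 := hg (r - τ)
    rw [sub_add_cancel, h4] at h5
    exact hfix _ h5.symm
  have hb' : b = ⊤ := by
    by_contra hne
    obtain ⟨r, rfl⟩ : ∃ r : ℝ, (r : EReal) = b := ⟨b.toReal, EReal.coe_toReal hne hb⟩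
    have h4 := h2 r (r + τ) (by linarith) le_rfl
    rw [hg r] at h4
    exact hfix _ h4.symm
  subst ha' hb'
  exact h3 s t (EReal.bot_lt_coe s) hst (EReal.coe_lt_top t)

theorem FS.const_of_periodic {X : Type*} [MetricSpace X] {c : FS X} {τ : ℝ} (hτ : 0 < τ)
    (hg : ∀ t, c.1 (t + τ) = c.1 t) (s t : ℝ) : c.1 s = c.1 t := by
  have hper : Function.Periodic c.1 τ := hg
  obtain ⟨a, b, -, ha, hb, h1, h2, h3⟩ := c.2.exists_bounds
  by_cases hab : a = ⊥
  · by_cases hbt : b = ⊤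
    · subst hab hbt
      have h4 := h3 0 τ (EReal.bot_lt_coe _) hτ.le (EReal.coe_lt_top _)
      have h5 := hg 0
      rw [zero_add] at h5
      rw [h5, dist_self] at h4
      linarith
    · obtain ⟨r, rfl⟩ : ∃ r : ℝ, (r : EReal) = b := ⟨b.toReal, EReal.coe_toReal hbt hb⟩
      have h4 : ∀ u, c.1 u = c.1 r := fun u => by
        obtain ⟨n, hn⟩ := Archimedean.arch (r - u) hτ
        rw [nsmul_eq_mul] at hn
        rw [← hper.nat_mul n u]
        exact (h2 r _ (by linarith) le_rfl).symm
      rw [h4 s, h4 t]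
  · obtain ⟨r, rfl⟩ : ∃ r : ℝ, (r : EReal) = a := ⟨a.toReal, EReal.coe_toReal ha hab⟩
    have h4 : ∀ u, c.1 u = c.1 r := fun u => by
      obtain ⟨n, hn⟩ := Archimedean.arch (u - r) hτ
      rw [nsmul_eq_mul] at hn
      rw [← hper.sub_nat_mul_eq n]
      exact h1 _ r (by linarith) le_rfl
    rw [h4 s, h4 t]

/-- Two bi-infinite geodesics of a real tree at bounded distance differ by a shift. -/
theorem FourPoint.exists_eq_flow {X : Type*} [MetricSpace X] (hX : FourPoint X) {c d : FS X}
    (hiso : ∀ s t, s ≤ t → dist (c.1 s) (c.1 t) = t - s) {D : ℝ} (hD : 0 < D)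
    (hcd : ∀ t, dist (d.1 t) (c.1 t) ≤ D) : ∃ s, d = FS.flow s c := by
  -- On each bounded window `d` is a shift of `c`; all windows contain `0`, and injectivity of `c`
  -- forces the shifts to agree.
  have key : ∀ N : ℝ, 0 ≤ N → ∃ s, ∀ t, |t| ≤ N → d.1 t = c.1 (t + s) := by
    intro N hN
    obtain ⟨s, -, hs⟩ := hX.exists_shift (c := c) (c' := d) (a := -(N + 5 * D)) (b := N + 5 * D) hD
      (by linarith) (fun s t _ h _ => hiso s t h) fun t _ _ => hcd t
    exact ⟨s, fun t ht => hs t (by linarith [(abs_le.1 ht).1]) (by linarith [(abs_le.1 ht).2])⟩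
  have hinj : ∀ s t, c.1 s = c.1 t → s = t := by
    intro s t hst
    rcases le_total s t with h | h
    · have := hiso s t h
      rw [hst, dist_self] at this
      linarith
    · have := hiso t s h
      rw [hst, dist_self] at this
      linarith
  obtain ⟨s, hs⟩ := key 0 le_rfl
  refine ⟨s, Subtype.ext (funext fun t => ?_)⟩
  obtain ⟨s', hs'⟩ := key |t| (abs_nonneg t)
  have h1 := hs 0 (by simp)
  rw [hs' 0 (by simp)] at h1
  have h2 := hinj _ _ h1
  rw [hs' t le_rfl, FS.flow_apply, add_left_cancel h2]

/-- If `g` translates the bi-infinite geodesics `c` and `d`, then they differ by a shift. -/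
theorem FourPoint.exists_eq_flow_of_equivariant {X G : Type*} [MetricSpace X] [Group G]
    [MulAction G X] [IsIsometricSMul G X] (hX : FourPoint X) {c d : FS X} {g : G} {τ σ : ℝ}
    (hτ : 0 < τ) (hσ : 0 < σ)
    (hc : ∀ s t, s ≤ t → dist (c.1 s) (c.1 t) = t - s)
    (hd : ∀ s t, s ≤ t → dist (d.1 s) (d.1 t) = t - s)
    (hgc : ∀ t, c.1 (t + σ) = g • c.1 t) (hgd : ∀ t, d.1 (t + τ) = g • d.1 t) :
    ∃ s, d = FS.flow s c := by
  have hzpow : ∀ (f : ℝ → X) (ρ : ℝ), (∀ t, f (t + ρ) = g • f t) → ∀ n : ℤ,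
      f (n * ρ) = g ^ n • f 0 := by
    intro f ρ hf n
    induction n with
    | zero => simp
    | succ n ih =>
      rw [add_comm (n : ℤ), zpow_one_add, mul_smul, ← ih, ← hf]
      push_cast
      ring_nf
    | pred n ih =>
      rw [sub_eq_neg_add, zpow_add, mul_smul, ← ih, zpow_neg_one,
        eq_inv_smul_iff, ← hf]
      push_cast
      ring_nf
  have hD : ∀ n : ℤ, dist (d.1 (n * τ)) (c.1 (n * σ)) = dist (d.1 0) (c.1 0) := fun n => by
    rw [hzpow d.1 τ hgd, hzpow c.1 σ hgc, dist_smul]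
  -- The powers of `g` keep `d(nτ)` and `c(nσ)` at a fixed distance, whereas unequal translation
  -- lengths would separate them linearly in `n`.
  have hτσ : τ = σ := by
    by_contra hne
    obtain ⟨n, hn⟩ := Archimedean.arch (2 * dist (d.1 0) (c.1 0) + 1) (abs_pos.2 (sub_ne_zero.2 hne))
    rw [nsmul_eq_mul] at hn
    have h1 := hD n
    rw [Int.cast_natCast] at h1
    have h2 := hc 0 (n * σ) (by positivity)
    have h3 := hd 0 (n * τ) (by positivity)
    have h4 := dist_triangle4 (c.1 0) (d.1 0) (d.1 (n * τ)) (c.1 (n * σ))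
    have h5 := dist_triangle4 (d.1 0) (c.1 0) (c.1 (n * σ)) (d.1 (n * τ))
    rw [dist_comm (c.1 0) (d.1 0)] at h4
    rw [dist_comm (c.1 (n * σ)) (d.1 (n * τ))] at h5
    have h6 : (n : ℝ) * |τ - σ| = |n * τ - n * σ| := by
      rw [← mul_sub, abs_mul, Nat.abs_cast]
    have h7 : |n * τ - n * σ| ≤ 2 * dist (d.1 0) (c.1 0) := abs_le.2 ⟨by linarith, by linarith⟩
    linarith
  subst hτσ
  refine hX.exists_eq_flow hc (D := dist (d.1 0) (c.1 0) + 2 * τ) (by positivity) fun t => ?_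
  have h1 := hD ⌊t / τ⌋
  have h2 := d.2.dist_le t (⌊t / τ⌋ * τ)
  have h3 := c.2.dist_le (⌊t / τ⌋ * τ) t
  have h4 := dist_triangle4 (d.1 t) (d.1 (⌊t / τ⌋ * τ)) (c.1 (⌊t / τ⌋ * τ)) (c.1 t)
  have h5 : |t - ⌊t / τ⌋ * τ| ≤ τ := by
    have h6 := Int.floor_le (t / τ)
    have h7 := Int.lt_floor_add_one (t / τ)
    rw [le_div_iff₀ hτ] at h6
    rw [div_lt_iff₀ hτ] at h7
    rw [abs_le]
    constructor <;> linarith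
  rw [abs_sub_comm] at h3
  linarith

variable {K : Type*} [Field K] [NumberField K] {x : 𝓞 K} [NeZero x]

variable (x) in
/-- The bi-infinite geodesic in the tree that joins the distinguished end to `β ∈ K`. -/
noncomputable def verticalLine (ε : ℤˣ) (β : K) : FS (Tree x) := ⟨fun t => Tree.mk' x ((ε : ℤ) * t) β, by
  refine isGeneralizedGeodesic_of_bounds
    ((Tree.isometry_mk' β).continuous.comp (by fun_prop)) ⊥ ⊤ bot_le
    (fun s t _ h => absurd h not_lt_bot) (fun s t _ h => absurd h not_top_lt) fun s t _ hst _ => ?_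
  rw [Tree.dist_mk', ← mul_sub, abs_mul, abs_sub_comm, abs_of_nonneg (sub_nonneg.2 hst)]
  rcases Int.units_eq_one_or ε with rfl | rfl <;> simp⟩

theorem verticalLine_apply (ε : ℤˣ) (β : K) (t : ℝ) :
    (verticalLine x ε β).1 t = Tree.mk' x ((ε : ℤ) * t) β := rfl

theorem dist_verticalLine (ε : ℤˣ) (β : K) {s t : ℝ} (hst : s ≤ t) :
    dist ((verticalLine x ε β).1 s) ((verticalLine x ε β).1 t) = t - s := by
  rw [verticalLine_apply, verticalLine_apply, Tree.dist_mk', ← mul_sub, abs_mul, abs_sub_comm,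
    abs_of_nonneg (sub_nonneg.2 hst)]
  rcases Int.units_eq_one_or ε with rfl | rfl <;> simp

/-- Modulo `1 - xᵐ` the element `x` is a unit, so inverting it creates no new residue classes. -/
theorem exists_invRing_residue {m : ℕ} (hm : 0 < m) {S : Set (𝓞 K)}
    (hS : ∀ z, ∃ s ∈ S, ∃ r, z = s + (1 - x ^ m) * r) {b : K} (hb : b ∈ InvRing x) :
    ∃ s ∈ S, ∃ a ∈ InvRing x, b = s + (1 - (x : K) ^ m) * a := by
  obtain ⟨n, z, hz⟩ := exists_pow_mul_mem_integers hb
  -- The integer `x^(mn - n) z` equals `x^(mn) b`, which is congruent to `b` since `1 - xᵐ` divides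
  -- `1 - x^(mn)`.
  obtain ⟨s, hs, r, hr⟩ := hS (x ^ (m * n - n) * z)
  obtain ⟨q, hq⟩ : 1 - x ^ m ∣ 1 - (x ^ m) ^ n := by simpa using sub_dvd_pow_sub_pow 1 (x ^ m) n
  refine ⟨s, hs, r + q * b, add_mem (coe_mem_invRing r) (mul_mem (coe_mem_invRing q) hb), ?_⟩
  have h1 : (x : K) ^ (m * n) * b = ((x ^ (m * n - n) * z : 𝓞 K) : K) := by
    rw [← Nat.sub_add_cancel (Nat.le_mul_of_pos_left n hm), pow_add, mul_assoc, hz,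
      Nat.sub_add_cancel (Nat.le_mul_of_pos_left n hm)]
    push_cast
    rfl
  have h2 : 1 - (x : K) ^ (m * n) = (1 - (x : K) ^ m) * q := by
    rw [pow_mul]; exact_mod_cast congrArg (algebraMap (𝓞 K) K) hq
  rw [hr] at h1
  push_cast at h1
  linear_combination h1 + b * h2

variable {ι : Type*} [Fintype ι] [DecidableEq ι] {e : Basis ι ℤ (𝓞 K)}

theorem xMatrix_pow_sub_one (m : ℕ) : xMatrix e (x ^ m - 1) = xMatrix e x ^ m - 1 := by
  have h : ∀ y, xMatrix e y =
      ((Int.castRingHom ℝ).mapMatrix (Algebra.leftMulMatrix e y))ᵀ := fun y => by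
    ext i j; simp [xMatrix, Algebra.leftMulMatrix_eq_repr_mul]
  rw [h, h, map_sub, map_sub, map_pow, map_pow, map_one, map_one, Matrix.transpose_sub,
    Matrix.transpose_pow, Matrix.transpose_one]

/-- `A_xᵐ - 1` is the matrix of multiplication by the nonzero element `xᵐ - 1`, hence invertible. -/
theorem eq_zero_of_vecMul_zpow (hx : ∀ m : ℕ, 0 < m → (x : K) ^ m ≠ 1) {k : ℤ} (hk : k ≠ 0)
    {u : ι → ℝ} (hu : u ᵥ* (xMatrix e x ^ k) = u) : u = 0 := by
  have hA := isUnit_det_xMatrix e x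
  have key : ∀ m : ℕ, 0 < m → u ᵥ* (xMatrix e x ^ m) = u → u = 0 := by
    intro m hm h
    have hne : NeZero (x ^ m - 1) := ⟨fun h0 => hx m hm (by
      have := congrArg (algebraMap (𝓞 K) K) (sub_eq_zero.1 h0)
      exact_mod_cast this)⟩
    have h1 : u ᵥ* xMatrix e (x ^ m - 1) = 0 := by
      rw [xMatrix_pow_sub_one, Matrix.vecMul_sub, h, Matrix.vecMul_one, sub_self]
    have h2 := congrArg (fun v => v ᵥ* (xMatrix e (x ^ m - 1))⁻¹) h1
    simp only [Matrix.vecMul_vecMul, Matrix.zero_vecMul] at h2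
    rwa [Matrix.mul_nonsing_inv _ (isUnit_det_xMatrix e _), Matrix.vecMul_one] at h2
  rcases Int.eq_nat_or_neg k with ⟨m, rfl | rfl⟩
  · exact key m (by omega) (by rwa [zpow_natCast] at hu)
  · refine key m (by omega) ?_
    conv_lhs => rw [← hu]
    rw [Matrix.vecMul_vecMul, Matrix.zpow_neg hA, zpow_natCast, Matrix.nonsing_inv_mul _ ?_,
      Matrix.vecMul_one]
    rw [Matrix.det_pow]
    exact hA.pow m

theorem HFS.flowLine_smul (g : Gamma x) (p : HFS x e) :
    HFS.flowLine (g • p) = g • HFS.flowLine p := by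
  unfold HFS.flowLine
  rw [← Set.image_smul, ← Set.range_comp]
  rfl

theorem HFS.flowLine_flow (τ : ℝ) (p : HFS x e) :
    HFS.flowLine (HFS.flow τ p) = HFS.flowLine p := by
  have h : ∀ s, HFS.flow s (HFS.flow τ p) = HFS.flow (s + τ) p := fun s =>
    Prod.ext (Subtype.ext (funext fun t => congrArg p.1.1 (add_assoc t s τ))) rfl
  ext q
  constructor
  · rintro ⟨s, rfl⟩
    exact ⟨s + τ, (h s).symm⟩
  · rintro ⟨s, rfl⟩
    refine ⟨s - τ, ?_⟩
    change HFS.flow (s - τ) (HFS.flow τ p) = HFS.flow s p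
    rw [h, sub_add_cancel]

/-- The point of the flow space given by `β ∈ K`: the geodesic from the distinguished end to `β`
(or back), paired with the coordinates of `β`. -/
noncomputable def verticalPoint (e : Basis ι ℤ (𝓞 K)) (x : 𝓞 K) [NeZero x] (ε : ℤˣ) (β : K) : HFS x e :=
  (verticalLine x ε β, coords e β)

theorem smul_verticalPoint_of_k_eq_zero {a : K} (ha : a ∈ InvRing x) (ε : ℤˣ) (β : K) :
    (Gamma.mk ⟨a, ha⟩ 0 : Gamma x) • verticalPoint e x ε β = verticalPoint e x ε (β + a) := by
  refine Prod.ext (Subtype.ext (funext fun t => ?_)) ?_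
  · change Gamma.mk ⟨a, ha⟩ 0 • Tree.mk' x _ β = Tree.mk' x _ (β + a)
    rw [Tree.smul_mk']
    simp
  · have h : affineMap e (Gamma.mk ⟨a, ha⟩ 0 : Gamma x) (coords e β) = coords e (β + a) := by
      rw [affineMap, coords_add]
      simp
    exact h

/-- An element `g = (b, k)` with `k ≠ 0` has one fixed point `β` in `K`. It translates the vertical
line to `β`, so two-sided geodesics translated by `g` are shifts of that line, and its only fixed
vector in `ℝⁿ` is given by the coordinates of `β`. The height change `|k|` is at most the period
time used. -/
theorem exists_verticalPoint_of_period (hx : ∀ m : ℕ, 0 < m → (x : K) ^ m ≠ 1) {p : HFS x e}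
    {C : ℝ} (hp0 : 0 < HFS.period p) (hpC : HFS.period p < ENNReal.ofReal C) :
    ∃ (m : ℕ) (ε : ℤˣ) (β : K), 0 < m ∧ (m : ℝ) < C ∧ (1 - (x : K) ^ m) * β ∈ InvRing x ∧
      HFS.flowLine p = HFS.flowLine (verticalPoint e x ε β) := by
  obtain ⟨_, ⟨τ, hτ, ⟨g, hg⟩, rfl⟩, hτC⟩ := sInf_lt_iff.1 hpC
  obtain ⟨c, w⟩ := p
  change ι → ℝ at w
  have hgc : ∀ t, c.1 (t + τ) = g • c.1 t := fun t =>
    congrFun (congrArg (fun q : HFS x e => q.1.1) hg) t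
  have hgw : affineMap e g w = w := (congrArg Prod.snd hg).symm
  have hC : τ < C := (ENNReal.ofReal_lt_ofReal_iff_of_nonneg hτ.le).1 hτC
  have hk : g.k ≠ 0 := by
    intro hk
    have hb : g.b = 0 := by
      rw [affineMap, hk, zpow_zero, Matrix.vecMul_one, add_eq_left] at hgw
      exact coords_injective (e := e) (hgw.trans (coords_zero e).symm)
    have hg1 : g = 1 := Gamma.ext_bk hb hk
    rw [hg1] at hgc
    have hconst := FS.const_of_periodic hτ fun t => (hgc t).trans (one_smul _ _)
    -- A constant `c` is fixed by the flow, so arbitrarily small times qualify, contradicting a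
    -- positive period.
    obtain ⟨r, hr, hr0, hrp⟩ := ENNReal.lt_iff_exists_real_btwn.1 hp0
    refine absurd hrp (not_lt.2 (sInf_le ⟨r, ENNReal.ofReal_pos.1 hr0, ⟨1, ?_⟩, rfl⟩))
    rw [one_smul]
    exact Prod.ext (Subtype.ext (funext fun t => hconst _ _)) rfl
  have hfix : ∀ q : Tree x, g • q ≠ q := by
    intro q hq
    have := congrArg Tree.height hq
    rw [Tree.smul_height, add_eq_left] at this
    exact hk (by exact_mod_cast this)
  have hiso := fun s t (hst : s ≤ t) => FS.dist_eq_of_equivariant hτ hgc hfix hst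
  have hkτ : |(g.k : ℝ)| ≤ τ := by
    have h1 := Tree.abs_height_sub_le_dist (c.1 0) (c.1 (0 + τ))
    rw [hiso 0 (0 + τ) (by linarith), hgc, Tree.smul_height, sub_add_cancel_left, abs_neg] at h1
    linarith
  have hne : 1 - (x : K) ^ g.k ≠ 0 := by
    intro h
    rw [sub_eq_zero, eq_comm] at h
    rcases Int.eq_nat_or_neg g.k with ⟨m, hm | hm⟩
    · rw [hm, zpow_natCast] at h
      exact hx m (by omega) h
    · rw [hm, zpow_neg, inv_eq_one, zpow_natCast] at h
      exact hx m (by omega) h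
  obtain ⟨β, hβ⟩ : ∃ β, (1 - (x : K) ^ g.k) * β = g.b := ⟨_, mul_div_cancel₀ _ hne⟩
  -- The sign of `k` decides whether the line runs away from the distinguished end or towards it.
  obtain ⟨ε, hε⟩ : ∃ ε : ℤˣ, (ε : ℤ) * |g.k| = g.k := by
    rcases abs_choice g.k with h | h
    · exact ⟨1, by rw [h]; simp⟩
    · exact ⟨-1, by rw [h]; simp⟩
  have hline : ∀ t, (verticalLine x ε β).1 (t + |(g.k : ℝ)|) = g • (verticalLine x ε β).1 t := by
    intro t
    rw [verticalLine_apply, verticalLine_apply, Tree.smul_mk', ← hβ]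
    congr 1
    · have : ((ε : ℤ) : ℝ) * |(g.k : ℝ)| = g.k := by exact_mod_cast hε
      rw [mul_add, this]
    · ring
  obtain ⟨s, hs⟩ := (Tree.fourPoint x).exists_eq_flow_of_equivariant hτ
    (abs_pos.2 (Int.cast_ne_zero.2 hk)) (fun s t => dist_verticalLine ε β) hiso hline hgc
  have hw : w = coords e β := by
    have h1 : affineMap e g (coords e β) = coords e β := by
      rw [affineMap, ← coords_zpow_mul, ← coords_add, ← hβ]
      congr 1
      ring
    have h2 : (w - coords e β : ι → ℝ) ᵥ* (xMatrix e x ^ g.k) = w - coords e β := by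
      rw [Matrix.sub_vecMul]
      rw [affineMap] at hgw h1
      rw [← eq_sub_iff_add_eq] at hgw h1
      rw [hgw, h1]
      abel
    exact sub_eq_zero.1 (eq_zero_of_vecMul_zpow hx hk h2)
  refine ⟨g.k.natAbs, ε, β, Int.natAbs_pos.2 hk, ?_, ?_, ?_⟩
  · rw [Nat.cast_natAbs, Int.cast_abs]; linarith
  · rcases Int.natAbs_eq g.k with h | h
    · have h1 : (1 - (x : K) ^ g.k.natAbs) * β = g.b := by
        rw [← hβ]; conv_rhs => rw [h, zpow_natCast]
      rw [h1]
      exact g.b_mem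
    -- For negative `k` the identity `1 - x^|k| = -x^|k| (1 - xᵏ)` changes the denominator by a unit
    -- of `𝓞_K[1/x]`.
    · have h1 : (1 - (x : K) ^ g.k.natAbs) * β = -((x : K) ^ (g.k.natAbs : ℤ) * g.b) := by
        rw [← hβ]
        conv_rhs => rw [h, zpow_neg, Int.natAbs_neg, Int.natAbs_natCast, zpow_natCast]
        have := pow_ne_zero g.k.natAbs (coe_ne_zero x)
        field_simp
        ring
      rw [h1]
      exact neg_mem (mul_mem (zpow_mem_invRing _) g.b_mem)
  · rw [← HFS.flowLine_flow s (verticalPoint e x ε β)]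
    congr 1
    exact Prod.ext hs hw

/-- Translations in `Γ` move `β` by `𝓞_K[1/x]`, and `(1 - xᵐ) β` has finitely many residues modulo
`1 - xᵐ`. There are finitely many `m < C` and two directions. -/
theorem finite_orbits_flowLine (hx : ∀ m : ℕ, 0 < m → (x : K) ^ m ≠ 1) (C : ℝ) :
    {O : Set (Set (HFS x e)) | ∃ p : HFS x e, 0 < HFS.period p ∧
      HFS.period p < ENNReal.ofReal C ∧
      O = MulAction.orbit (Gamma x) (HFS.flowLine p)}.Finite := by
  have hres : ∀ m : ℕ, ∃ S : Set (𝓞 K), S.Finite ∧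
      (0 < m → ∀ z, ∃ s ∈ S, ∃ r, z = s + (1 - x ^ m) * r) := by
    intro m
    rcases Nat.eq_zero_or_pos m with rfl | hm
    · exact ⟨∅, Set.finite_empty, fun h => absurd h (lt_irrefl 0)⟩
    · obtain ⟨S, hS, h⟩ := exists_finite_residues (y := 1 - x ^ m) (fun h0 => hx m hm (by
        have := congrArg (algebraMap (𝓞 K) K) (sub_eq_zero.1 h0)
        exact_mod_cast this.symm))
      exact ⟨S, hS, fun _ => h⟩
  choose S hSfin hS using hres
  have hfin : (⋃ m ∈ Set.Iic ⌈C⌉₊, ⋃ ε : ℤˣ, (fun s : 𝓞 K => MulAction.orbit (Gamma x)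
      (HFS.flowLine (verticalPoint e x ε ((s : K) / (1 - (x : K) ^ m))))) '' S m).Finite :=
    (Set.finite_Iic ⌈C⌉₊).biUnion fun m _ => Set.finite_iUnion fun _ => (hSfin m).image _
  refine hfin.subset ?_
  rintro _ ⟨p, hp0, hpC, rfl⟩
  obtain ⟨m, ε, β, hm, hmC, hβ, hp⟩ := exists_verticalPoint_of_period hx hp0 hpC
  obtain ⟨s, hs, a, ha, hsa⟩ := exists_invRing_residue hm (hS m hm) hβ
  refine Set.mem_biUnion (x := m) ?_ (Set.mem_iUnion.2 ⟨ε, s, hs, ?_⟩)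
  · exact Nat.cast_le.1 (hmC.le.trans (Nat.le_ceil C))
  · have hne : 1 - (x : K) ^ m ≠ 0 := sub_ne_zero.2 (hx m hm).symm
    have hβ' : β = (s : K) / (1 - (x : K) ^ m) + a := by
      field_simp
      linear_combination hsa
    beta_reduce
    rw [hp, hβ', ← smul_verticalPoint_of_k_eq_zero ha, HFS.flowLine_smul, MulAction.orbit_smul]

end Periods

/-! ### Zero-dimensional pieces and covering dimension -/

section ZeroDimensional

open Filter Topology

variable {Y Z : Type*} [TopologicalSpace Y] [TopologicalSpace Z]

/-- The points of `S` have arbitrarily small neighbourhoods whose traces on `S` are relatively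
clopen, the separating open sets being disjoint in the ambient space. -/
def ZeroDimIn (S : Set Y) : Prop :=
  ∀ p ∈ S, ∀ U ∈ 𝓝 p, ∃ O O' : Set Y, IsOpen O ∧ IsOpen O' ∧ Disjoint O O' ∧ p ∈ O ∧ O ⊆ U ∧
    S ⊆ O ∪ O'

theorem ZeroDimIn.preimage {f : Y → Z} (hf : IsInducing f) {S : Set Z} (hS : ZeroDimIn S) :
    ZeroDimIn (f ⁻¹' S) := by
  intro p hp U hU
  rw [hf.nhds_eq_comap] at hU
  obtain ⟨V, hV, hVU⟩ := hU
  obtain ⟨O, O', hO, hO', hd, hpO, hOV, hcov⟩ := hS (f p) hp V hV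
  exact ⟨f ⁻¹' O, f ⁻¹' O', hO.preimage hf.continuous, hO'.preimage hf.continuous, hd.preimage f,
    hpO, (Set.preimage_mono hOV).trans hVU, fun y hy => hcov hy⟩

theorem ZeroDimIn.prod {S : Set Y} {T : Set Z} (hS : ZeroDimIn S) (hT : ZeroDimIn T) :
    ZeroDimIn (S ×ˢ T) := by
  rintro ⟨p, q⟩ ⟨hp, hq⟩ U hU
  obtain ⟨V, hV, W, hW, hVW⟩ := mem_nhds_prod_iff.1 hU
  obtain ⟨O, O', hO, hO', hd, hpO, hOV, hcov⟩ := hS p hp V hV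
  obtain ⟨Q, Q', hQ, hQ', hd', hqQ, hQW, hcov'⟩ := hT q hq W hW
  refine ⟨O ×ˢ Q, O' ×ˢ Set.univ ∪ Set.univ ×ˢ Q', hO.prod hQ,
    (hO'.prod isOpen_univ).union (isOpen_univ.prod hQ'), ?_, ⟨hpO, hqQ⟩,
    (Set.prod_mono hOV hQW).trans hVW, ?_⟩
  · rw [Set.disjoint_left] at *
    rintro ⟨y, z⟩ ⟨hy, hz⟩ (⟨h, -⟩ | ⟨-, h⟩)
    exacts [hd hy h, hd' hz h]
  · rintro ⟨y, z⟩ ⟨hy, hz⟩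
    rcases hcov hy with h | h
    · rcases hcov' hz with h' | h'
      · exact Or.inl ⟨h, h'⟩
      · exact Or.inr (Or.inr ⟨trivial, h'⟩)
    · exact Or.inr (Or.inl ⟨h, trivial⟩)

theorem ZeroDimIn.pi {κ : Type*} {Y : κ → Type*} [∀ i, TopologicalSpace (Y i)]
    {S : ∀ i, Set (Y i)} (hS : ∀ i, ZeroDimIn (S i)) : ZeroDimIn (Set.univ.pi S) := by
  intro p hp U hU
  rw [nhds_pi, Filter.mem_pi] at hU
  obtain ⟨I, hI, V, hV, hVU⟩ := hU
  choose O O' hO hO' hd hpO hOV hcov using fun i => hS i (p i) (hp i trivial) (V i) (hV i)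
  refine ⟨I.pi O, ⋃ i ∈ I, Function.eval i ⁻¹' O' i, isOpen_set_pi hI fun i _ => hO i,
    isOpen_biUnion fun i _ => (hO' i).preimage (continuous_apply i), ?_, fun i _ => hpO i,
    (Set.pi_mono fun i _ => hOV i).trans hVU, fun y hy => ?_⟩
  · refine Set.disjoint_left.2 fun y hy hy' => ?_
    obtain ⟨i, hi, h⟩ := Set.mem_iUnion₂.1 hy'
    exact Set.disjoint_left.1 (hd i) (hy i hi) h
  · by_cases h : y ∈ I.pi O
    · exact Or.inl h
    · simp only [Set.mem_pi, not_forall] at h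
      obtain ⟨i, hi, h⟩ := h
      exact Or.inr (Set.mem_biUnion hi ((hcov i (hy i trivial)).resolve_left h))

theorem zeroDimIn_compl_real {D : Set ℝ} (hD : ∀ a b, a < b → ∃ d ∈ D, a < d ∧ d < b) :
    ZeroDimIn Dᶜ := by
  intro p hp U hU
  obtain ⟨a, b, ⟨hap, hpb⟩, hab⟩ := mem_nhds_iff_exists_Ioo_subset.1 hU
  obtain ⟨d, hd, had, hdp⟩ := hD a p hap
  obtain ⟨d', hd', hpd', hdb'⟩ := hD p b hpb
  refine ⟨Set.Ioo d d', Set.Iio d ∪ Set.Ioi d', isOpen_Ioo, isOpen_Iio.union isOpen_Ioi, ?_,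
    ⟨hdp, hpd'⟩, (Set.Ioo_subset_Ioo had.le hdb'.le).trans hab, fun y hy => ?_⟩
  · refine Set.disjoint_left.2 ?_
    rintro y ⟨h1, h2⟩ (h | h)
    exacts [lt_asymm h1 h, lt_asymm h2 h]
  · have h1 : y ≠ d := fun h => hy (h ▸ hd)
    have h2 : y ≠ d' := fun h => hy (h ▸ hd')
    rcases h1.lt_or_gt with h | h
    · exact Or.inr (Or.inl h)
    rcases h2.lt_or_gt with h' | h'
    · exact Or.inl ⟨h, h'⟩
    · exact Or.inr (Or.inr h')

/-- By Lindelöf, countably many of the sets `O` cover `S`; disjointing them splits `S` into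
relatively clopen pieces, which are then thickened to disjoint open sets of the ambient space. -/
theorem ZeroDimIn.exists_disjoint_refinement {Y : Type*} [PseudoEMetricSpace Y]
    [SecondCountableTopology Y] {S : Set Y} (hS : ZeroDimIn S) {𝒰 : Set (Set Y)}
    (hU : ∀ U ∈ 𝒰, IsOpen U) (hcov : ⋃₀ 𝒰 = Set.univ) :
    ∃ 𝒱 : Set (Set Y), (∀ V ∈ 𝒱, IsOpen V) ∧ S ⊆ ⋃₀ 𝒱 ∧ (∀ V ∈ 𝒱, ∃ U ∈ 𝒰, V ⊆ U) ∧
      ∀ p, {V | V ∈ 𝒱 ∧ p ∈ V}.Subsingleton := by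
  rcases S.eq_empty_or_nonempty with rfl | hne
  · exact ⟨∅, by simp, by simp, by simp, fun p V hV => absurd hV.1 (by simp)⟩
  have hloc : ∀ p ∈ S, ∃ U ∈ 𝒰, ∃ O O' : Set Y, IsOpen O ∧ IsOpen O' ∧ Disjoint O O' ∧ p ∈ O ∧
      O ⊆ U ∧ S ⊆ O ∪ O' := by
    intro p hp
    obtain ⟨U, hU𝒰, hpU⟩ := Set.mem_sUnion.1 (hcov ▸ Set.mem_univ p)
    exact ⟨U, hU𝒰, hS p hp U ((hU U hU𝒰).mem_nhds hpU)⟩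
  choose! U hU𝒰 O O' hO hO' hd hpO hOU hSO using hloc
  obtain ⟨t, htS, ht, hSt⟩ := TopologicalSpace.countable_cover_nhdsWithin (f := O) (s := S)
    fun p hp => mem_nhdsWithin_of_mem_nhds ((hO p hp).mem_nhds (hpO p hp))
  have htne : t.Nonempty := by
    obtain ⟨p, hp⟩ := hne
    obtain ⟨q, hq, -⟩ := Set.mem_iUnion₂.1 (hSt hp)
    exact ⟨q, hq⟩
  obtain ⟨f, rfl⟩ := ht.exists_eq_range htne
  have hfS : ∀ k, f k ∈ S := fun k => htS ⟨k, rfl⟩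
  let W : ℕ → Set Y := fun k => S ∩ disjointed (fun j => O (f j)) k
  -- The points closer to `W k` than to the rest of `S`. For different indices these sets are
  -- disjoint, because each piece lies in the complement of the other.
  let G : ℕ → Set Y := fun k =>
    {y | Metric.infEDist y (W k) < Metric.infEDist y (S \ W k)} ∩ U (f k)
  have hGopen : ∀ k, IsOpen (G k) := fun k =>
    (isOpen_lt Metric.continuous_infEDist Metric.continuous_infEDist).inter
      (hU _ (hU𝒰 _ (hfS k)))
  have hWG : ∀ k, W k ⊆ G k := by
    intro k y hy
    refine ⟨?_, hOU _ (hfS k) (disjointed_subset _ k hy.2)⟩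
    change Metric.infEDist y (W k) < Metric.infEDist y (S \ W k)
    rw [Metric.infEDist_zero_of_mem hy, pos_iff_ne_zero, Ne, ← Metric.mem_closure_iff_infEDist_zero]
    intro hcl
    have hN : IsOpen (O (f k) ∩ ⋂ j ∈ Set.Iio k, O' (f j)) :=
      (hO _ (hfS k)).inter ((Set.finite_Iio k).isOpen_biInter fun j _ => hO' _ (hfS j))
    have hnot : ∀ j < k, y ∉ O (f j) := fun j hj => by
      have h := hy.2
      rw [disjointed_eq_inter_compl] at h
      exact Set.mem_iInter₂.1 h.2 j hj
    have hyN : y ∈ O (f k) ∩ ⋂ j ∈ Set.Iio k, O' (f j) :=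
      ⟨disjointed_subset _ k hy.2, Set.mem_iInter₂.2 fun j hj =>
        (hSO _ (hfS j) hy.1).resolve_left (hnot j hj)⟩
    obtain ⟨z, ⟨hz1, hz2⟩, hzS, hzW⟩ := mem_closure_iff.1 hcl _ hN hyN
    refine hzW ⟨hzS, ?_⟩
    rw [disjointed_eq_inter_compl]
    exact ⟨hz1, Set.mem_iInter₂.2 fun j hj h =>
      Set.disjoint_left.1 (hd _ (hfS j)) h (Set.mem_iInter₂.1 hz2 j hj)⟩
  have hGdisj : ∀ j k, j ≠ k → Disjoint (G j) (G k) := by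
    intro j k hjk
    have hWdisj : ∀ j k, j ≠ k → W j ⊆ S \ W k := fun j k hjk y hy =>
      ⟨hy.1, fun h => Set.disjoint_left.1 (disjoint_disjointed _ hjk) hy.2 h.2⟩
    refine Set.disjoint_left.2 fun y hy hy' => ?_
    have h1 := hy.1.trans_le (Metric.infEDist_anti (hWdisj k j hjk.symm))
    have h2 := hy'.1.trans_le (Metric.infEDist_anti (hWdisj j k hjk))
    exact lt_asymm h1 h2
  refine ⟨Set.range G, ?_, ?_, ?_, ?_⟩
  · rintro _ ⟨k, rfl⟩
    exact hGopen k
  · intro y hy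
    obtain ⟨k, hk⟩ := Set.mem_iUnion.1 ((iUnion_disjointed (f := fun j => O (f j))).symm ▸
      (show y ∈ ⋃ j, O (f j) by simpa using hSt hy))
    exact ⟨G k, ⟨k, rfl⟩, hWG k ⟨hy, hk⟩⟩
  · rintro _ ⟨k, rfl⟩
    exact ⟨U (f k), hU𝒰 _ (hfS k), Set.inter_subset_right⟩
  · rintro p _ ⟨⟨j, rfl⟩, hj⟩ _ ⟨⟨k, rfl⟩, hk⟩
    by_contra hne
    exact Set.disjoint_left.1 (hGdisj j k fun h => hne (h ▸ rfl)) hj hk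

/-- A union of `n + 1` zero-dimensional subspaces has covering dimension at most `n`. -/
theorem coveringDimLE_of_zeroDimIn [SecondCountableTopology Y]
    [TopologicalSpace.PseudoMetrizableSpace Y] {n : ℕ} (S : Fin (n + 1) → Set Y)
    (hS : ∀ i, ZeroDimIn (S i)) (hcov : ∀ p, ∃ i, p ∈ S i) : CoveringDimLE Y n := by
  let := TopologicalSpace.pseudoMetrizableSpacePseudoMetric Y
  intro 𝒰 hU hUcov
  choose 𝒱 hopen hcover href hsub using fun i => (hS i).exists_disjoint_refinement hU hUcov
  refine ⟨⋃ i, 𝒱 i, fun V hV => ?_, Set.eq_univ_of_forall fun p => ?_, fun V hV => ?_, fun p => ?_⟩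
  · obtain ⟨i, hi⟩ := Set.mem_iUnion.1 hV
    exact hopen i V hi
  · obtain ⟨i, hi⟩ := hcov p
    obtain ⟨V, hV, hpV⟩ := hcover i hi
    exact ⟨V, Set.mem_iUnion.2 ⟨i, hV⟩, hpV⟩
  · obtain ⟨i, hi⟩ := Set.mem_iUnion.1 hV
    exact href i V hi
  · have hidx : ∀ V, V ∈ {V | V ∈ ⋃ i, 𝒱 i ∧ p ∈ V} → ∃ i, V ∈ 𝒱 i := fun V hV =>
      Set.mem_iUnion.1 hV.1
    choose! idx hidx using hidx
    -- Each of the `n + 1` disjoint families contributes at most one member containing `p`.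
    have h := Set.encard_le_encard_of_injOn (f := idx) (s := {V | V ∈ ⋃ i, 𝒱 i ∧ p ∈ V})
      (t := Set.univ) (fun V _ => trivial) fun V hV W hW hVW =>
        hsub (idx V) p ⟨hidx V hV, hV.2⟩ ⟨hVW ▸ hidx W hW, hW.2⟩
    simpa using h

end ZeroDimensional

/-! ### Dimension and local connectedness of the flow space -/

section TreeDimension

set_option linter.unusedSectionVars false

open Filter Topology

variable {K : Type*} [Field K] [NumberField K] {x : 𝓞 K} [NeZero x]

theorem Tree.continuous_meet (p : Tree x) : Continuous fun q : Tree x => p.meet q := by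
  have key : ∀ q r : Tree x, p.meet q - dist q r ≤ p.meet r := by
    intro q r
    refine le_trans (le_min ?_ ?_) (Tree.min_meet_le p r q)
    · linarith [dist_nonneg (x := q) (y := r)]
    · linarith [Tree.height_sub_dist_le_meet q r, Tree.meet_le_right p q]
  refine (LipschitzWith.of_dist_le_mul (K := 1) fun q r => ?_).continuous
  rw [NNReal.coe_one, one_mul, Real.dist_eq, abs_le]
  have h1 := key q r
  have h2 := key r q
  rw [dist_comm] at h2
  constructor <;> linarith

/-- Cut the tree at heights `d < d'` of `D` around that of `p`. The piece between them that branches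
off the ray from `p` above `d` is open and small, and it is separated from the remaining points
whose heights avoid `D`. -/
theorem Tree.zeroDimIn_height {D : Set ℝ} (hD : ∀ a b, a < b → ∃ d ∈ D, a < d ∧ d < b) :
    ZeroDimIn {p : Tree x | p.height ∉ D} := by
  intro p hp U hU
  obtain ⟨ε, hε, hεU⟩ := Metric.mem_nhds_iff.1 hU
  obtain ⟨d, hd, hd1, hd2⟩ := hD (p.height - ε / 4) p.height (by linarith)
  obtain ⟨d', hd', hd1', hd2'⟩ := hD p.height (p.height + ε / 4) (by linarith)
  have hbranch : IsOpen {q : Tree x | d < q.height ∧ p.meet q ≤ d} := by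
    refine Metric.isOpen_iff.2 fun q ⟨hq, hq'⟩ => ⟨q.height - d, sub_pos.2 hq, fun r hr => ?_⟩
    rw [Metric.mem_ball, dist_comm] at hr
    have h1 := abs_le.1 (Tree.abs_height_sub_le_dist q r)
    refine ⟨by linarith [h1.2], ?_⟩
    by_contra! hcon
    have h2 := Tree.min_meet_le p q r
    have h3 := Tree.height_sub_dist_le_meet q r
    rw [Tree.meet_comm] at h3
    rcases min_le_iff.1 h2 with h | h <;> linarith
  refine ⟨{q | d < p.meet q ∧ q.height < d'},
    {q | q.height < d} ∪ {q | d' < q.height} ∪ {q | d < q.height ∧ p.meet q ≤ d},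
    (isOpen_lt continuous_const (Tree.continuous_meet p)).inter
      (isOpen_lt Tree.continuous_height continuous_const),
    ((isOpen_lt Tree.continuous_height continuous_const).union
      (isOpen_lt continuous_const Tree.continuous_height)).union hbranch, ?_,
    ⟨by rw [Tree.meet_self]; exact hd2, hd1'⟩, ?_, ?_⟩
  · refine Set.disjoint_left.2 ?_
    rintro q ⟨h1, h2⟩ ((h | h) | ⟨-, h⟩)
    · exact lt_asymm h (h1.trans_le (Tree.meet_le_right p q))
    · exact lt_asymm h h2
    · exact absurd h1 (not_lt.2 h)
  · rintro q ⟨h1, h2⟩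
    refine hεU ?_
    rw [Metric.mem_ball, dist_comm, Tree.dist_def]
    linarith
  · intro q hq
    have h1 : q.height ≠ d := fun h => hq (h ▸ hd)
    have h2 : q.height ≠ d' := fun h => hq (h ▸ hd')
    rcases h1.lt_or_gt with h | h
    · exact Or.inr (Or.inl (Or.inl h))
    rcases h2.lt_or_gt with h' | h'
    · rcases lt_or_ge d (p.meet q) with h3 | h3
      · exact Or.inl ⟨h3, h'⟩
      · exact Or.inr (Or.inr ⟨h, h3⟩)
    · exact Or.inr (Or.inl (Or.inr h'))

instance : SecondCountableTopology (Tree x) := by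
  have hK : Countable K := (finBasis ℚ K).equivFun.injective.countable
  have : TopologicalSpace.SeparableSpace (Tree x) := by
    refine ⟨Set.range fun p : ℚ × K => Tree.mk' x p.1 p.2, Set.countable_range _, fun p => ?_⟩
    refine Metric.mem_closure_iff.2 fun ε hε => ?_
    obtain ⟨a, ha⟩ := p.nonempty
    obtain ⟨q, hq1, hq2⟩ := exists_rat_btwn (sub_lt_self p.height hε)
    refine ⟨_, ⟨(q, a), rfl⟩, ?_⟩
    rw [Tree.eq_mk' ha, Tree.dist_mk', abs_lt]
    constructor <;> linarith
  exact UniformSpace.secondCountable_of_separable _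

instance : SecondCountableTopology (FS (Tree x)) := FS.isInducing_eval.secondCountableTopology

/-- A geodesic path through a point descends before it or ascends after it. -/
theorem Tree.height_of_dist_eq_add {p q r : Tree x} (h : dist p r = dist p q + dist q r) :
    q.height = p.height - dist p q ∨ r.height = q.height + dist q r := by
  have h1 := Tree.min_meet_le p r q
  have h2 := Tree.meet_le_right p q
  have h3 := Tree.meet_le_left q r
  simp only [Tree.dist_def] at *
  rcases min_le_iff.1 h1 with h | h
  · right; linarith
  · left; linarith

theorem exists_common_rat_class {P : ℚ → Prop} {h : ℚ → ℝ}
    (hP : ∀ q q', P q → P q' → ∃ s : ℚ, h q = h q' + s) :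
    ∃ r : ℝ, ∀ q, P q → ∃ s : ℚ, h q = r + s := by
  by_cases hne : ∃ q, P q
  · obtain ⟨q', hq'⟩ := hne
    exact ⟨h q', fun q hq => hP q q' hq hq'⟩
  · exact ⟨0, fun q hq => absurd ⟨q, hq⟩ hne⟩

/-- The heights of a generalized geodesic at rational times lie in at most four classes
modulo `ℚ`. -/
theorem FS.exists_height_classes (c : FS (Tree x)) :
    ∃ r : Fin 4 → ℝ, ∀ q : ℚ, ∃ j, ∃ s : ℚ, (c.1 q).height = r j + s := by
  obtain ⟨a, b, -, -, -, h1, h2, h3⟩ := c.2.exists_bounds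
  obtain ⟨h, hh⟩ : ∃ h : ℚ → ℝ, ∀ q, h q = (c.1 q).height := ⟨_, fun _ => rfl⟩
  have hsub : ∀ {P : ℚ → Prop}, (∀ q q' : ℚ, q ≤ q' → P q → P q' → ∃ s : ℚ, h q = h q' + s) →
      ∃ r : ℝ, ∀ q, P q → ∃ s : ℚ, h q = r + s := by
    intro P hP
    refine exists_common_rat_class fun q q' hq hq' => ?_
    rcases le_total q q' with hle | hle
    · exact hP q q' hle hq hq'
    · obtain ⟨s, hs⟩ := hP q' q hle hq' hq
      exact ⟨-s, by rw [hs]; push_cast; ring⟩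
  let I : ℚ → Prop := fun q => a < ((q : ℝ) : EReal) ∧ ((q : ℝ) : EReal) < b
  obtain ⟨r₀, hr₀⟩ := hsub (P := fun q => ((q : ℝ) : EReal) ≤ a) fun q q' hqq _ hq' =>
    ⟨0, by rw [hh, hh, h1 q q' (by exact_mod_cast hqq) hq']; simp⟩
  obtain ⟨r₁, hr₁⟩ := hsub (P := fun q => b ≤ ((q : ℝ) : EReal)) fun q q' hqq hq _ =>
    ⟨0, by rw [hh, hh, h2 q q' (by exact_mod_cast hqq) hq]; simp⟩
  obtain ⟨r₂, hr₂⟩ := hsub (P := fun q => I q ∧ ∀ s : ℚ, I s → s ≤ q → h q = h s - (q - s))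
    fun q q' hqq hq hq' => ⟨q' - q, by rw [hq'.2 q hq.1 hqq]; push_cast; ring⟩
  obtain ⟨r₃, hr₃⟩ := hsub (P := fun q => I q ∧ ∀ s : ℚ, I s → q ≤ s → h s = h q + (s - q))
    fun q q' hqq hq hq' => ⟨q - q', by rw [hq.2 q' hq'.1 hqq]; push_cast; ring⟩
  refine ⟨![r₀, r₁, r₂, r₃], fun q => ?_⟩
  rw [← hh]
  rcases le_or_gt ((q : ℝ) : EReal) a with hqa | hqa
  · exact ⟨0, hr₀ q hqa⟩
  rcases le_or_gt b ((q : ℝ) : EReal) with hqb | hqb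
  · exact ⟨1, hr₁ q hqb⟩
  -- On the moving interval a geodesic first descends and then ascends. The four classes come from
  -- the two resting ends and these two parts; on each part heights change by rational amounts
  -- between rational times.
  by_cases hdown : ∀ s : ℚ, I s → s ≤ q → h q = h s - (q - s)
  · exact ⟨2, hr₂ q ⟨⟨hqa, hqb⟩, hdown⟩⟩
  · push Not at hdown
    obtain ⟨s, hs, hsq, hne⟩ := hdown
    refine ⟨3, hr₃ q ⟨⟨hqa, hqb⟩, fun t ht hqt => ?_⟩⟩
    have hsq' : (s : ℝ) ≤ q := by exact_mod_cast hsq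
    have hqt' : (q : ℝ) ≤ t := by exact_mod_cast hqt
    have e1 := h3 s q hs.1 hsq' hqb
    have e2 := h3 q t hqa hqt' ht.2
    have e3 := h3 s t hs.1 (hsq'.trans hqt') ht.2
    rw [hh, hh] at hne
    rw [hh, hh, ← e2]
    rw [← e1] at hne
    exact (Tree.height_of_dist_eq_add (by linarith)).resolve_left hne

/-- Translates of `ℚ` by the integral multiples of `√2`. -/
def ratCoset (i : ℕ) : Set ℝ := {r | ∃ s : ℚ, r = i * Real.sqrt 2 + s}

theorem exists_mem_ratCoset (i : ℕ) (a b : ℝ) (hab : a < b) :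
    ∃ d ∈ ratCoset i, a < d ∧ d < b := by
  obtain ⟨q, hq1, hq2⟩ := exists_rat_btwn (sub_lt_sub_right hab (i * Real.sqrt 2))
  exact ⟨_, ⟨q, rfl⟩, by linarith, by linarith⟩

/-- Nonzero integral multiples of `√2` are irrational, so the cosets are distinct and a class modulo
`ℚ` equals at most one of them. -/
theorem ratCoset_eq {i j : ℕ} {r : ℝ} {s t : ℚ} (hi : r + s ∈ ratCoset i)
    (hj : r + t ∈ ratCoset j) : i = j := by
  obtain ⟨u, hu⟩ := hi
  obtain ⟨v, hv⟩ := hj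
  by_contra hne
  have hirr := irrational_sqrt_two.intCast_mul (sub_ne_zero.2 (show (i : ℤ) ≠ j by exact_mod_cast hne))
  refine hirr ⟨s - u - (t - v), ?_⟩
  push_cast
  linarith

theorem exists_forall_notMem_ratCoset {κ : Type*} [Fintype κ] (r : κ → ℝ) {N : ℕ}
    (hN : Fintype.card κ < N) : ∃ i : Fin N, ∀ j, ∀ s : ℚ, r j + s ∉ ratCoset i := by
  by_contra! hcon
  choose j s hjs using hcon
  obtain ⟨i, i', hne, hii⟩ := Fintype.exists_ne_map_eq_of_card_lt j (by simpa using hN)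
  have h := hjs i
  rw [hii] at h
  exact hne (Fin.ext (ratCoset_eq h (hjs i')))

variable {ι : Type*} [Fintype ι] [DecidableEq ι] {e : Basis ι ℤ (𝓞 K)}

instance : SecondCountableTopology (RSpace e) :=
  inferInstanceAs (SecondCountableTopology (ι → ℝ))

instance : TopologicalSpace.PseudoMetrizableSpace (RSpace e) :=
  inferInstanceAs (TopologicalSpace.PseudoMetrizableSpace (ι → ℝ))

/-- A point involves at most `n + 4` classes modulo `ℚ`: four from the heights at rational times and
`n` from the vector. So one of `n + 5` cosets is avoided altogether. The points avoiding a given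
coset form the preimage of a product of zero-dimensional sets. -/
theorem coveringDimLE_subtype_HFS (A : Set (HFS x e)) :
    CoveringDimLE A (Fintype.card ι + 4) := by
  let f : HFS x e → (ℚ → Tree x) × (ι → ℝ) := fun p => (fun q => p.1.1 q, p.2)
  have hid : IsInducing (fun w : RSpace e => (w : ι → ℝ)) := IsInducing.id
  have hf : IsInducing f := FS.isInducing_eval.prodMap hid
  let S : Fin (Fintype.card ι + 4 + 1) → Set ((ℚ → Tree x) × (ι → ℝ)) := fun i =>
    (Set.univ.pi fun _ : ℚ => {p : Tree x | p.height ∉ ratCoset i}) ×ˢ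
      (Set.univ.pi fun _ : ι => (ratCoset i)ᶜ)
  have hS : ∀ i, ZeroDimIn (S i) := fun i =>
    (ZeroDimIn.pi fun _ => Tree.zeroDimIn_height (exists_mem_ratCoset i)).prod
      (ZeroDimIn.pi fun _ => zeroDimIn_compl_real (exists_mem_ratCoset i))
  refine coveringDimLE_of_zeroDimIn (fun i => (f ∘ Subtype.val) ⁻¹' S i)
    (fun i => (hS i).preimage (hf.comp IsInducing.subtypeVal)) ?_
  rintro ⟨⟨c, w⟩, -⟩
  change ι → ℝ at w
  obtain ⟨r, hr⟩ := c.exists_height_classes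
  obtain ⟨i, hi⟩ := exists_forall_notMem_ratCoset (Sum.elim r w)
    (N := Fintype.card ι + 4 + 1) (by simp; omega)
  refine ⟨i, fun q _ => ?_, fun j _ hj => ?_⟩
  · obtain ⟨j, s, hs⟩ := hr q
    change (c.1 q).height ∉ ratCoset i
    rw [hs]
    exact hi (Sum.inl j) s
  · refine hi (Sum.inr j) 0 ?_
    simpa using hj

theorem HFS.isClosed_fixedSet : IsClosed (HFS.fixedSet x e) := by
  have h : HFS.fixedSet x e = ⋂ τ : ℝ, ⋂ t : ℝ, {p | p.1.1 (t + τ) = p.1.1 t} := by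
    ext p
    simp only [Set.mem_iInter]
    constructor
    · intro h τ t
      exact congrFun (congrArg (fun q : HFS x e => q.1.1) (h τ)) t
    · intro h τ
      exact Prod.ext (Subtype.ext (funext fun t => h τ t)) rfl
  rw [h]
  exact isClosed_iInter fun τ => isClosed_iInter fun t =>
    isClosed_eq ((FS.continuous_eval _).comp continuous_fst)
      ((FS.continuous_eval _).comp continuous_fst)

theorem locallyConnectedSpace_compl_fixedSet :
    LocallyConnectedSpace ↥(HFS.fixedSet x e)ᶜ := by
  refine locallyConnectedSpace_iff_connected_subsets.2 ?_
  rintro ⟨⟨c, w⟩, hp⟩ U hU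
  -- Points outside the fixed set are exactly those with non-constant `c`, where
  -- `FourPoint.exists_isPreconnected_nhds` applies.
  have hc : ∃ s t, c.1 s ≠ c.1 t := by
    by_contra! hcon
    exact hp fun τ => Prod.ext (Subtype.ext (funext fun t => hcon _ _)) rfl
  obtain ⟨U', hU', hUU⟩ := (mem_nhds_subtype _ _ _).1 hU
  obtain ⟨V, hV, W, hW, hVW⟩ := mem_nhds_prod_iff.1
    (Filter.inter_mem hU' (HFS.isClosed_fixedSet.isOpen_compl.mem_nhds hp))
  obtain ⟨ε, hε, hεV⟩ := Metric.mem_nhds_iff.1 hV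
  obtain ⟨V', hV', hV'c, hV'V⟩ := (Tree.fourPoint x).exists_isPreconnected_nhds hc hε
  have : LocallyConnectedSpace (RSpace e) := inferInstanceAs (LocallyConnectedSpace (ι → ℝ))
  obtain ⟨W', hW', hW'c, hW'W⟩ := locallyConnectedSpace_iff_connected_subsets.1 this w W hW
  have hsub : V' ×ˢ W' ⊆ U' ∩ (HFS.fixedSet x e)ᶜ :=
    (Set.prod_mono (hV'V.trans hεV) hW'W).trans hVW
  refine ⟨Subtype.val ⁻¹' (V' ×ˢ W'),
    continuous_subtype_val.continuousAt.preimage_mem_nhds (prod_mem_nhds hV' hW'), ?_,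
    fun q hq => hUU (hsub hq).1⟩
  rw [← IsInducing.subtypeVal.isPreconnected_image, Subtype.image_preimage_coe,
    Set.inter_eq_right.2 fun q hq => (hsub hq).2]
  exact hV'c.prod hW'c

end TreeDimension

/-! ### `Γ` is torsion free -/

section Torsion

variable {K : Type*} [Field K] {x : 𝓞 K} [NeZero x]

theorem Gamma.k_pow (g : Gamma x) (m : ℕ) : (g ^ m).k = m * g.k := by
  induction m with
  | zero => simp
  | succ m ih => rw [pow_succ, Gamma.k_mul, ih]; push_cast; ring

theorem Gamma.b_pow {g : Gamma x} (hg : g.k = 0) (m : ℕ) : (g ^ m).b = m * g.b := by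
  induction m with
  | zero => simp
  | succ m ih => rw [pow_succ', Gamma.b_mul, ih, hg, zpow_zero]; push_cast; ring

/-- Torsion dies in the quotient `ℤ`, and the kernel is an additive subgroup of a field of
characteristic zero. -/
theorem Gamma.eq_one_of_isOfFinOrder [CharZero K] {g : Gamma x} (hg : IsOfFinOrder g) : g = 1 := by
  obtain ⟨m, hm, h⟩ := isOfFinOrder_iff_pow_eq_one.1 hg
  have hk : g.k = 0 := by
    have := g.k_pow m
    rw [h, Gamma.k_one] at this
    have hm' : (m : ℤ) ≠ 0 := by exact_mod_cast hm.ne'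
    exact (mul_eq_zero.1 this.symm).resolve_left hm'
  refine Gamma.ext_bk ?_ hk
  have := Gamma.b_pow hk m
  rw [h, Gamma.b_one] at this
  exact (mul_eq_zero.1 this.symm).resolve_left (Nat.cast_ne_zero.2 hm.ne')

theorem finiteSubgroupBound_gamma [CharZero K] : finiteSubgroupBound (Gamma x) ≤ 1 := by
  refine sSup_le ?_
  rintro _ ⟨H, hH, rfl⟩
  have : Subsingleton H := ⟨fun g h => Subtype.ext (by
    rw [Gamma.eq_one_of_isOfFinOrder (Submonoid.isOfFinOrder_coe.2 (isOfFinOrder_of_finite g)),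
      Gamma.eq_one_of_isOfFinOrder (Submonoid.isOfFinOrder_coe.2 (isOfFinOrder_of_finite h))])⟩
  exact_mod_cast Finite.card_le_one_iff_subsingleton.2 this

end Torsion

/-- A root of an irreducible characteristic polynomial of an integral matrix whose determinant is
not a unit is not a root of unity. -/
theorem pow_ne_one_of_aeval_charpoly {n : ℕ} {A : Matrix (Fin n) (Fin n) ℤ} (hdet : 1 < |A.det|)
    (hirr : Irreducible (A.charpoly.map (Int.castRingHom ℚ))) {K : Type*} [Field K] [CharZero K]
    {y : K} (hroot : Polynomial.aeval y A.charpoly = 0) {m : ℕ} (hm : 0 < m) : y ^ m ≠ 1 := by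
  intro hy
  have hmonic := A.charpoly_monic
  have hmin : A.charpoly.map (Int.castRingHom ℚ) = minpoly ℚ y := by
    refine minpoly.eq_of_irreducible_of_monic hirr ?_ (hmonic.map _)
    rw [← hroot]
    exact Polynomial.aeval_map_algebraMap ℚ y A.charpoly
  have hdvd : A.charpoly ∣ Polynomial.X ^ m - 1 := by
    rw [← Polynomial.map_dvd_map (Int.castRingHom ℚ) Int.cast_injective hmonic, hmin]
    exact minpoly.dvd ℚ y (by simp [hy])
  -- If `yᵐ = 1`, the characteristic polynomial divides `Xᵐ - 1` already over `ℤ`, since it is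
  -- monic. At `0` this says that its constant term, which is the determinant up to sign, divides
  -- `-1`.
  have h0 := Polynomial.eval_dvd (x := 0) hdvd
  rw [Polynomial.eval_sub, Polynomial.eval_pow, Polynomial.eval_X, Polynomial.eval_one,
    zero_pow hm.ne', zero_sub, dvd_neg, ← Polynomial.coeff_zero_eq_eval_zero] at h0
  have h1 := Int.isUnit_iff_abs_eq.1 (isUnit_of_dvd_one h0)
  rw [A.det_eq_sign_charpoly_coeff, abs_mul, h1, abs_pow, abs_neg, abs_one, one_pow] at hdet
  norm_num at hdet

end HorizontalFlow

open HorizontalFlow in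
theorem lemma3p7 {n : ℕ} (A : Matrix (Fin n) (Fin n) ℤ) (hdet : 1 < |A.det|)
    (hirr : Irreducible (A.charpoly.map (Int.castRingHom ℚ)))
    {K : Type*} [Field K] [NumberField K] (x : 𝓞 K) [NeZero x]
    (hroot : Polynomial.aeval (x : K) A.charpoly = 0)
    (hgen : IntermediateField.adjoin ℚ {(x : K)} = ⊤)
    (e : Basis (Fin n) ℤ (𝓞 K)) :
    (ActsProperly (Gamma x) (HFS x e) ∧ ActsCocompactly (Gamma x) (HFS x e)) ∧
    (∀ C : ℝ, 0 < C →
      {O : Set (Set (HFS x e)) | ∃ p : HFS x e, 0 < HFS.period p ∧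
        HFS.period p < ENNReal.ofReal C ∧
        O = MulAction.orbit (Gamma x) (HFS.flowLine p)}.Finite) ∧
    LocallyConnectedSpace ↥(HFS.fixedSet x e)ᶜ ∧
    (finiteSubgroupBound (Gamma x) < ⊤ ∧ coveringDim ↥(HFS.fixedSet x e)ᶜ < ⊤) := by
  refine ⟨⟨actsProperly_HFS, actsCocompactly_HFS⟩, fun C _ => finite_orbits_flowLine
    (fun m hm => pow_ne_one_of_aeval_charpoly hdet hirr hroot hm) C,
    locallyConnectedSpace_compl_fixedSet, finiteSubgroupBound_gamma.trans_lt (by decide), ?_⟩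
  have h : coveringDim ↥(HFS.fixedSet x e)ᶜ ≤ (Fintype.card (Fin n) + 4 : ℕ) :=
    sInf_le ⟨_, coveringDimLE_subtype_HFS _, rfl⟩
  exact h.trans_lt (ENat.natCast_lt_top _)
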